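/- **Setting.** Let $(\mathcal N,\mathcal E)$ be a finite directed graph without self-loops, whose edges $e$ have lengths $l^e>0$ and weights $A^e>0$ and are identified with intervals $(0,l^e)$ (initial node at $0$, end node at $l^e$). Let $\mathcal N=\mathcal N_0\,\dot\cup\,\mathcal N_\partial$ be split into interior and boundary nodes, every boundary node $\nu_1,\dots,\nu_p$ being adjacent to exactly one edge. Put $n^e[\nu]=A^e$ if $e$ starts in $\nu$ and $n^e[\nu]=-A^e$ if $e$ ends in $\nu$. Let $L^2(\mathcal E)$ be the space of edgewise square-integrable functions with $\langle b,\tilde b\rangle=\sum_{e}A^e\int_e b\,\tilde b\,dx$ and $\|b\|=\langle b,b\rangle^{1/2}$; let $\partial_x$ be the edgewise weak derivative, $H^1_{pw}(\mathcal E)=\{b\in L^2(\mathcal E):\partial_x b\in L^2(\mathcal E)\}$, $$H^1_{div}(\mathcal E)=\Big\{b\in H^1_{pw}(\mathcal E):\ \sum_{e\ni\nu}n^e[\nu]\,b_{|e}[\nu]=0\ \text{ for all }\nu\in\mathcal N_0\Big\},$$ where $b_{|e}[\nu]$ is the value at the node $\nu$ of the continuous representative on $e$, and let $[\mathcal T b]_i=n^e[\nu_i]\,b_{|e}[\nu_i]$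 for $e$ the edge adjacent to $\nu_i$, $i=1,\dots,p$. Let $K_1,\dots,K_J$ be a partition of the edges into closed subintervals of positive length, each contained in one edge, with pairwise intersections of measure zero. Let $Q_f\subset L^2(\mathcal E)$ be the space of functions constant on every $K_j$, and $W_f\subset H^1_{div}(\mathcal E)$ the space of functions affine on every $K_j$. Let $Q\subset Q_f$ and $W\subset W_f$ be (finite dimensional) linear subspaces with $Q=\partial_x W$ and $\{w\in H^1_{div}(\mathcal E):\partial_x w=0\}\subset W$. Let $I\subset\{1,\dots,J\}$, $\xi_i>0$ for $i\in I$, and $$\langle b,\bar b\rangle_c=\sum_{i\in I}\xi_i\int_{K_i}b\,\bar b\,dx,\qquad \|b\|_c=\langle b,b\rangle_c^{1/2},$$ and assume that there is a constant $\tilde C\ge1$ with $\tilde C^{-1}\|b\|_c\le\|b\|\le\tilde C\|b\|_c$ for all $b\in Q\cup W$. Let $0<M<\infty$ and let $P:(0,M)\to\mathbb R$ be twice continuously differentiable with $P''(y)>0$ and $y\le\max\{P(y),1\}$ for all $y\in(0,M)$, and $\lim_{y\to M}P(y)=\infty$. Let the friction law be $r(\rho,m)=\rho^{-2}$. Let $(\rho_0,m_0)\in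 Q\times W$ with $\rho_0(x)\in(0,M)$ for (almost all) $x\in K_i$, $i\in I$. **Theorem.** For every $T>0$ and every continuous $\mathbf u:[0,T]\to\mathbb R^p$ there is exactly one $(\rho,m)\in C^1([0,T);Q\times W)$ with $\rho(0)=\rho_0$, $m(0)=m_0$, such that for all $t\in[0,T)$ the values of $\rho(t)$ on $K_i$, $i\in I$, lie in the domain $(0,M)$ of $P$, and $$\langle\partial_t\rho,q\rangle=-\langle\partial_x m,q\rangle\qquad\text{for all }q\in Q,$$ $$\Big\langle\partial_t\frac m\rho,w\Big\rangle_c=\Big\langle P'(\rho)+\frac{m^2}{2\rho^2},\partial_x w\Big\rangle_c-\langle r(\rho,m)\,m,w\rangle_c+\mathbf u\cdot\mathcal T w\qquad\text{for all }w\in W.$$ -/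

import Mathlib

open MeasureTheory Set Filter Topology

namespace GasNet

/-- A finite network of pipes: a directed graph without self-loops whose edges carry a length and a
weight, together with its boundary nodes (all other nodes are interior). Every boundary node is
connected to exactly one edge. (Finiteness of the set of edges is assumed where it is used.) -/
structure Network (V E : Type*) where
  src : E → V
  tgt : E → V
  src_ne_tgt : ∀ e, src e ≠ tgt e
  len : E → ℝ
  len_pos : ∀ e, 0 < len e
  area : E → ℝ
  area_pos : ∀ e, 0 < area e
  bdry : Finset V
  bdry_unique : ∀ ν ∈ bdry, ∃! e, src e = ν ∨ tgt e = ν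

variable {V E J : Type*}

namespace Network

/-- The space `L²(ℰ)`: a square-integrable function (up to null sets) on the interval `(0, l^e)`,
for every edge `e`. -/
abbrev L2 (N : Network V E) : Type _ :=
  ∀ e : E, Lp ℝ 2 (volume.restrict (Ioo 0 (N.len e)))

/-- Edgewise continuous functions, continuous up to the end points of the edges. Functions in
`H¹_pw(ℰ)` are identified with their (unique) edgewise continuous representative. -/
abbrev Cont (N : Network V E) : Type _ :=
  ∀ e : E, C(Icc 0 (N.len e), ℝ)

/-- Values of an element of `L²(ℰ)`, as functions of the edge and the position. -/
noncomputable def fn (N : Network V E) (q : N.L2) : E → ℝ → ℝ := fun e => (q e : ℝ → ℝ)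

/-- Values of an edgewise continuous function, as functions of the edge and the position. Only the
positions `x ∈ [0, l^e]` matter. -/
noncomputable def ev (N : Network V E) (b : N.Cont) : E → ℝ → ℝ :=
  fun e => IccExtend (N.len_pos e).le (b e)

/-- `g = ∂ₓ b` in the weak sense on every edge. -/
def HasWeakDeriv (N : Network V E) (b : N.Cont) (g : N.L2) : Prop :=
  ∀ e : E, ∀ φ : ℝ → ℝ, ContDiff ℝ (⊤ : ℕ∞) φ → HasCompactSupport φ →
    tsupport φ ⊆ Ioo 0 (N.len e) →
      ∫ x in Ioo 0 (N.len e), N.ev b e x * deriv φ x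
        = - ∫ x in Ioo 0 (N.len e), N.fn g e x * φ x

/-- The weak broken derivative in `L²(ℰ)` is unique. -/
theorem HasWeakDeriv.unique {N : Network V E} {b : N.Cont} {g h : N.L2}
    (hg : N.HasWeakDeriv b g) (hh : N.HasWeakDeriv b h) : g = h := by
  funext e
  have hgi : Integrable (N.fn g e) (volume.restrict (Ioo 0 (N.len e))) :=
    (Lp.memLp (g e)).integrable (by norm_num)
  have hhi : Integrable (N.fn h e) (volume.restrict (Ioo 0 (N.len e))) :=
    (Lp.memLp (h e)).integrable (by norm_num)
  apply Lp.ext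
  have key : ∀ᵐ x, x ∈ Ioo 0 (N.len e) → (N.fn g e x - N.fn h e x) = 0 := by
    apply isOpen_Ioo.ae_eq_zero_of_integral_contDiff_smul_eq_zero
      (f := fun x => N.fn g e x - N.fn h e x)
    · exact IntegrableOn.locallyIntegrableOn (hgi.sub hhi)
    · intro φ h1 h2 h3
      obtain ⟨C, hC⟩ := h2.exists_bound_of_continuous h1.continuous
      have i1 : Integrable (fun x => N.fn g e x * φ x) (volume.restrict (Ioo 0 (N.len e))) :=
        hgi.mul_bdd (c := C) h1.continuous.aestronglyMeasurable (Eventually.of_forall hC)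
      have i2 : Integrable (fun x => N.fn h e x * φ x) (volume.restrict (Ioo 0 (N.len e))) :=
        hhi.mul_bdd (c := C) h1.continuous.aestronglyMeasurable (Eventually.of_forall hC)
      have e1 := hg e φ h1 h2 h3
      have e2 := hh e φ h1 h2 h3
      have e3 : ∫ x in Ioo 0 (N.len e), (N.fn g e x * φ x - N.fn h e x * φ x) = 0 := by
        rw [integral_sub i1 i2]; linarith
      rw [← setIntegral_eq_integral_of_forall_compl_eq_zero (s := Ioo 0 (N.len e))]
      · have e4 : (fun x => φ x • (N.fn g e x - N.fn h e x))
            = fun x => N.fn g e x * φ x - N.fn h e x * φ x := by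
          funext x
          simp only [smul_eq_mul]
          ring
        rw [e4]
        exact e3
      · intro x hx
        have : φ x = 0 := image_eq_zero_of_notMem_tsupport fun hx' => hx (h3 hx')
        simp [this]
  have key' := (ae_restrict_iff' (μ := volume) measurableSet_Ioo).2 key
  filter_upwards [key'] with x hx
  exact sub_eq_zero.1 hx

open Classical in
/-- The weak broken derivative `∂ₓ b ∈ L²(ℰ)` of `b ∈ H¹_pw(ℰ)` (zero by convention, and never used,
if `b` has no weak derivative in `L²(ℰ)`). -/
noncomputable def dx (N : Network V E) (b : N.Cont) : N.L2 :=
  if h : ∃ g, N.HasWeakDeriv b g then h.choose else 0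

theorem HasWeakDeriv.dx_eq {N : Network V E} {b : N.Cont} {g : N.L2}
    (hg : N.HasWeakDeriv b g) : N.dx b = g := by
  have h : ∃ g, N.HasWeakDeriv b g := ⟨g, hg⟩
  rw [dx, dif_pos h]
  exact h.choose_spec.unique hg

open Classical in
/-- The weighted incidence mapping `n^e[ν]`: `A^e` if `e` starts in `ν`, `-A^e` if it ends there
(and `0` if `e` is not adjacent to `ν`). -/
noncomputable def inc (N : Network V E) (e : E) (ν : V) : ℝ :=
  if N.src e = ν then N.area e else if N.tgt e = ν then -N.area e else 0

open Classical in
/-- The node evaluation `b_{|e}[ν]`, for an edge `e` adjacent to `ν`: the initial node of `e` is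
`x = 0`, its end node is `x = l^e`. -/
noncomputable def nodeVal (N : Network V E) (b : N.Cont) (e : E) (ν : V) : ℝ :=
  if N.src e = ν then N.ev b e 0 else N.ev b e (N.len e)

variable [Fintype E]

/-- `∑ n^e[ν] b_{|e}[ν]` over the edges adjacent to `ν` (the other ones contribute `0`). -/
noncomputable def nodeFlux (N : Network V E) (b : N.Cont) (ν : V) : ℝ :=
  ∑ e, N.inc e ν * N.nodeVal b e ν

/-- The boundary operator `𝒯`: since a boundary node has exactly one adjacent edge `e`, the sum is
the single term `n^e[ν] b_{|e}[ν]`. -/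
noncomputable def trace (N : Network V E) (b : N.Cont) : N.bdry → ℝ :=
  fun ν => N.nodeFlux b ν

/-- `H¹_pw(ℰ)`: the functions with a weak broken derivative in `L²(ℰ)`. -/
def H1pw (N : Network V E) : Set N.Cont := {b | ∃ g, N.HasWeakDeriv b g}

/-- `H¹_div(ℰ)`: the functions in `H¹_pw(ℰ)` fulfilling the coupling condition at all interior
nodes. -/
def H1div (N : Network V E) : Set N.Cont :=
  {b | b ∈ N.H1pw ∧ ∀ ν, ν ∉ N.bdry → N.nodeFlux b ν = 0}

/-- The scalar product `⟨f, g⟩ = ∑ₑ A^e ∫ₑ f g dx`. -/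
noncomputable def ip (N : Network V E) (f g : E → ℝ → ℝ) : ℝ :=
  ∑ e, N.area e * ∫ x in Ioo 0 (N.len e), f e x * g e x

/-- Compatibility of the ansatz spaces: `Q ⊆ L²(ℰ)` and `W ⊆ H¹_div(ℰ)` are finite dimensional
subspaces with `Q = ∂ₓ W`, and `W` contains the kernel of `∂ₓ` on `H¹_div(ℰ)`. -/
structure CompatibleSpaces (N : Network V E) (Q : Submodule ℝ N.L2) (W : Submodule ℝ N.Cont) :
    Prop where
  finite_Q : FiniteDimensional ℝ Q
  finite_W : FiniteDimensional ℝ W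
  W_sub : (W : Set N.Cont) ⊆ N.H1div
  Q_eq : (Q : Set N.L2) = N.dx '' (W : Set N.Cont)
  ker_sub : {w | w ∈ N.H1div ∧ N.dx w = 0} ⊆ (W : Set N.Cont)

end Network

/-- A partition of the edges into finitely many cells: the cell `K_j` is a subinterval
`[lo j, hi j]` of positive length of the edge `edge j`; the cells cover all edges and their
pairwise intersections are null sets. -/
structure Mesh (N : Network V E) (J : Type*) where
  edge : J → E
  lo : J → ℝ
  hi : J → ℝ
  lo_lt_hi : ∀ j, lo j < hi j
  sub : ∀ j, Icc (lo j) (hi j) ⊆ Icc 0 (N.len (edge j))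
  cover : ∀ e, ∀ x ∈ Icc 0 (N.len e), ∃ j, edge j = e ∧ x ∈ Icc (lo j) (hi j)
  overlap : ∀ j k, j ≠ k → edge j = edge k → volume (Icc (lo j) (hi j) ∩ Icc (lo k) (hi k)) = 0

namespace Mesh

variable {N : Network V E}

/-- The cell `K_j`. -/
def cell (K : Mesh N J) (j : J) : Set ℝ := Icc (K.lo j) (K.hi j)

/-- `Q_f`: the piecewise constant functions. -/
def Qf (K : Mesh N J) : Set N.L2 :=
  {q | ∀ j, ∃ ζ : ℝ, ∀ᵐ x ∂(volume.restrict (K.cell j)), N.fn q (K.edge j) x = ζ}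

/-- `W_f`: the piecewise affine functions in `H¹_div(ℰ)`. -/
def Wf [Fintype E] (K : Mesh N J) : Set N.Cont :=
  {w | w ∈ N.H1div ∧ ∀ j, ∃ ξ μ : ℝ, ∀ x ∈ K.cell j, N.ev w (K.edge j) x = ξ + μ * x}

/-- The quadrature-type bilinear form `⟨f, g⟩_c = ∑_{i ∈ I} ξ_i ∫_{K_i} f g dx`. -/
noncomputable def quad (K : Mesh N J) (I : Finset J) (ξ : J → ℝ) (f g : E → ℝ → ℝ) : ℝ :=
  ∑ i ∈ I, ξ i * ∫ x in K.cell i, f (K.edge i) x * g (K.edge i) x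

/-- Compatibility of the bilinear form: on `Q ∪ W` the induced norm `‖b‖_c = ⟨b, b⟩_c^{1/2}` is
equivalent to the `L²`-norm. (The non-negativity of `f ↦ ⟨f, 1⟩_c` on non-negative `f` is automatic
for non-negative weights.) -/
def CompatibleForm [Fintype E] (K : Mesh N J) (I : Finset J) (ξ : J → ℝ)
    (Q : Submodule ℝ N.L2) (W : Submodule ℝ N.Cont) : Prop :=
  ∃ C : ℝ, 1 ≤ C ∧ ∀ b ∈ (N.fn '' (Q : Set N.L2)) ∪ (N.ev '' (W : Set N.Cont)),
    C⁻¹ * √(K.quad I ξ b b) ≤ √(N.ip b b) ∧ √(N.ip b b) ≤ C * √(K.quad I ξ b b)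

/-- On every cell `K_i`, `i ∈ I`, the function `ρ` takes its values in `(0, M)`. -/
def InRange (K : Mesh N J) (I : Finset J) (M : ℝ) (ρ : N.L2) : Prop :=
  ∀ i ∈ I, ∀ᵐ x ∂(volume.restrict (K.cell i)), N.fn ρ (K.edge i) x ∈ Ioo 0 M

end Mesh

/-- The pressure potential `P : (0, M) → ℝ` is twice continuously differentiable with `P'' > 0` and
`y ≤ max {P y, 1}` on `(0, M)`, and `P y → ∞` as `y → M`. -/
structure PressurePotential (M : ℝ) (P : ℝ → ℝ) : Prop where
  contDiff : ContDiffOn ℝ 2 P (Ioo 0 M)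
  deriv2_pos : ∀ y ∈ Ioo 0 M, 0 < deriv (deriv P) y
  le_max : ∀ y ∈ Ioo 0 M, y ≤ max (P y) 1
  blowup : Tendsto P (𝓝[<] M) atTop

/-- `x = (ρ, m) ∈ C¹([0, T); Q × W)` solves the complexity-reduced model with pressure potential
`P : (0, M) → ℝ`, friction law `r`, boundary data `u` and initial data `(ρ₀, m₀)`. Part of being a
solution is that the density takes values in the domain `(0, M)` of `P` wherever it is evaluated in
the nonlinear terms. Since `w` does not depend on time, `⟨∂ₜ(m/ρ), w⟩_c` is the time derivative
of `⟨m/ρ, w⟩_c`. -/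
structure IsSolution [Fintype E] {N : Network V E} (K : Mesh N J) (I : Finset J) (ξ : J → ℝ)
    (Q : Submodule ℝ N.L2) (W : Submodule ℝ N.Cont) (M : ℝ) (P : ℝ → ℝ) (r : ℝ → ℝ → ℝ)
    (T : ℝ) (u : ℝ → N.bdry → ℝ) (ρ₀ : Q) (m₀ : W) (x : ℝ → Q × W) : Prop where
  contDiff : ContDiffOn ℝ 1 x (Ico 0 T)
  init : x 0 = (ρ₀, m₀)
  inRange : ∀ t ∈ Ico 0 T, K.InRange I M (x t).1
  mass : ∀ t ∈ Ico 0 T, ∀ q ∈ Q,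
    N.ip (N.fn ((derivWithin x (Ico 0 T) t).1 : N.L2)) (N.fn q)
      = - N.ip (N.fn (N.dx (x t).2)) (N.fn q)
  momentum : ∀ t ∈ Ico 0 T, ∀ w ∈ W,
    HasDerivWithinAt
      (fun s => K.quad I ξ (fun e y => N.ev (x s).2 e y / N.fn (x s).1 e y) (N.ev w))
      (K.quad I ξ
          (fun e y => deriv P (N.fn (x t).1 e y)
            + (N.ev (x t).2 e y) ^ 2 / (2 * (N.fn (x t).1 e y) ^ 2))
          (N.fn (N.dx w))
        - K.quad I ξ
          (fun e y => r (N.fn (x t).1 e y) (N.ev (x t).2 e y) * N.ev (x t).2 e y) (N.ev w)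
        + ∑ ν, u t ν * N.trace w ν)
      (Ico 0 T) t

end GasNet

/-! Densities are constant on each cell, so `⟨m/ρ, w⟩_c` is a finite sum of forms on `W` weighted by
`1/ρ`. Definiteness on `W` makes `m ↦ ⟨m/ρ, ·⟩_c` invertible while `0 < ρ < M`, and the model
becomes a controlled equation `x' = g(x, u)` with `g` of class `C¹` on an open set. Local theory
gives uniqueness; existence up to `T` only needs trajectories confined to a compact subset of that
set (`exists_hasDerivWithinAt_of_apriori`).

The confinement comes from the energy `H = ⟨m²/(2ρ) + P(ρ), 1⟩_c`. Testing the momentum equation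
with `w = m` gives `H' = -D + u · 𝒯m` with `D = ⟨m²/ρ², 1⟩_c`. As `ρ < M`, `D` dominates `‖m‖²`, and
Young's inequality yields `H' ≤ -D/2 + c`. Since `P` is bounded below and blows up at `M`, a bound
on `H` bounds `m` and keeps `ρ` away from `M`.

Keeping `ρ` away from `0` is the delicate point, and it uses the friction law `ρ⁻²`. On a cell,
`(log ρ)' = -∂ₓm/ρ`. The inverse estimate for affine functions bounds `(∂ₓm/ρ)²` by a multiple of
`D`, so `log ρ` decreases at rate at most `D/2 + c'`. The energy pays for this loss: `log ρ - H + (c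
+ c')t` is nondecreasing (`log_sub_energy_le`), and `H` is bounded below. -/

namespace GasNet

/-! ### Controlled differential equations on an open set -/

section ODE

open scoped Manifold NNReal

/-- A `C¹` map on an open set agrees, near a compact subset, with a compactly supported `C¹` map. -/
theorem exists_contDiff_hasCompactSupport_eqOn {X Y : Type*} [NormedAddCommGroup X]
    [NormedSpace ℝ X] [FiniteDimensional ℝ X] [NormedAddCommGroup Y] [NormedSpace ℝ Y]
    {U K : Set X} (hU : IsOpen U) (hK : IsCompact K) (hKU : K ⊆ U) {g : X → Y}
    (hg : ContDiffOn ℝ 1 g U) :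
    ∃ (h : X → Y) (V : Set X), ContDiff ℝ 1 h ∧ HasCompactSupport h ∧ IsOpen V ∧ K ⊆ V ∧ V ⊆ U ∧
      EqOn h g V := by
  have : ProperSpace X := FiniteDimensional.proper ℝ X
  obtain ⟨K', hK', hKK', hK'U⟩ := exists_compact_between hK hU hKU
  -- A cutoff equal to `1` near `K` and supported in the compact `K' ⊆ U`; thus `χ • g` is `C¹` even
  -- at points where nothing is known about `g`.
  obtain ⟨χ, h0, h1, -⟩ := exists_contMDiffMap_zero_one_nhds_of_isClosed (n := 1) 𝓘(ℝ, X)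
    (isOpen_interior (s := K')).isClosed_compl hK.isClosed
    (by rwa [← subset_compl_iff_disjoint_left, compl_compl])
  have hχ : ContDiff ℝ 1 χ := χ.contMDiff.contDiff
  have hsupp : Function.support χ ⊆ K' := by
    intro x hx
    by_contra hx'
    exact hx (h0.self_of_nhdsSet x fun h => hx' (interior_subset h))
  have hts : tsupport χ ⊆ K' := closure_minimal hsupp hK'.isClosed
  obtain ⟨V, hV, hKV, hV1⟩ := mem_nhdsSet_iff_exists.1 h1
  refine ⟨fun x => χ x • g x, V ∩ U, ?_, ?_, hV.inter hU, subset_inter hKV hKU,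
    inter_subset_right, ?_⟩
  · rw [contDiff_iff_contDiffAt]
    intro x
    by_cases hx : x ∈ U
    · exact hχ.contDiffAt.smul (hg.contDiffAt (hU.mem_nhds hx))
    · have hx' : x ∉ tsupport χ := fun h => hx (hK'U (hts h))
      have : (fun x => χ x • g x) =ᶠ[𝓝 x] fun _ => 0 := by
        filter_upwards [notMem_tsupport_iff_eventuallyEq.1 hx'] with y hy
        simp [hy]
      exact contDiffAt_const.congr_of_eventuallyEq this
  · exact HasCompactSupport.of_support_subset_isCompact hK' fun x hx => hsupp fun h => hx (by simp [h])
  · intro x hx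
    have : χ x = 1 := hV1 hx.1
    simp [this]

variable {E F : Type*} [NormedAddCommGroup E] [NormedSpace ℝ E] [FiniteDimensional ℝ E]
  [NormedAddCommGroup F] [NormedSpace ℝ F] [FiniteDimensional ℝ F]

/-- A controlled vector field of class `C¹` agrees, near a compact set of states and for controls
in a compact set, with a bounded and globally Lipschitz one. -/
theorem exists_lipschitz_eqOn {U K : Set E} {B : Set F} (hU : IsOpen U) (hK : IsCompact K)
    (hKU : K ⊆ U) (hB : IsCompact B) {g : E × F → E} (hg : ContDiffOn ℝ 1 g (U ×ˢ univ)) :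
    ∃ (h : E × F → E) (V : Set E) (C L : ℝ≥0), LipschitzWith C h ∧ (∀ z, ‖h z‖ ≤ L) ∧
      IsOpen V ∧ K ⊆ V ∧ V ⊆ U ∧ ∀ x ∈ V, ∀ v ∈ B, h (x, v) = g (x, v) := by
  obtain ⟨h, V, hh, hc, hV, hKV, hVU, heq⟩ := exists_contDiff_hasCompactSupport_eqOn
    (hU.prod isOpen_univ) (hK.prod hB) (prod_mono hKU (subset_univ B)) hg
  obtain ⟨C, hC⟩ := hh.lipschitzWith_of_hasCompactSupport hc one_ne_zero
  obtain ⟨L, hL⟩ := hc.exists_bound_of_continuous hh.continuous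
  obtain ⟨V₁, V₂, hV₁, -, hKV₁, hBV₂, hV₁₂⟩ := generalized_tube_lemma hK hB hV hKV
  refine ⟨h, V₁ ∩ U, C, L.toNNReal, hC, fun z => (hL z).trans (Real.le_coe_toNNReal L),
    hV₁.inter hU, subset_inter hKV₁ hKU, inter_subset_right, fun x hx v hv => ?_⟩
  exact heq (hV₁₂ ⟨hx.1, hBV₂ hv⟩)

/-- A curve of speed at most `L` moves by at most `L * T`, so on a ball of that radius a single
application of Picard–Lindelöf covers all of `[0, T]`. -/
theorem exists_hasDerivWithinAt_of_lipschitz {F : Type*} [NormedAddCommGroup F] {T : ℝ} (hT : 0 ≤ T) {u : ℝ → F}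
    (hu : ContinuousOn u (Icc 0 T)) {h : E × F → E} {C L : ℝ≥0} (hC : LipschitzWith C h)
    (hL : ∀ z, ‖h z‖ ≤ L) (x₀ : E) :
    ∃ x : ℝ → E, x 0 = x₀ ∧
      ∀ t ∈ Icc 0 T, HasDerivWithinAt x (h (x t, u t)) (Icc 0 T) t := by
  have : CompleteSpace E := FiniteDimensional.complete ℝ E
  have hpl : IsPicardLindelof (fun t x => h (x, u t)) (⟨0, left_mem_Icc.2 hT⟩ : Icc 0 T) x₀
      (L * T.toNNReal) 0 L C := by
    refine ⟨fun t _ => ?_, fun x _ => ?_, fun t _ x _ => hL _, ?_⟩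
    · have := hC.comp (LipschitzWith.prodMk_right (α := E) (u t))
      rw [mul_one] at this
      exact this.lipschitzOnWith
    · exact hC.continuous.comp_continuousOn (continuousOn_const.prodMk hu)
    · rw [NNReal.coe_mul, Real.coe_toNNReal T hT]
      simp [hT]
  exact hpl.exists_eq_forall_mem_Icc_hasDerivWithinAt₀

/-- Uniqueness for the controlled differential equation `x' = g (x, u t)`. -/
theorem eqOn_of_hasDerivWithinAt {U : Set E} (hU : IsOpen U) {g : E × F → E}
    (hg : ContDiffOn ℝ 1 g (U ×ˢ univ)) {T : ℝ} {u : ℝ → F} (hu : ContinuousOn u (Icc 0 T))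
    {x y : ℝ → E} (hxy : x 0 = y 0) (hxU : ∀ t ∈ Ico 0 T, x t ∈ U)
    (hyU : ∀ t ∈ Ico 0 T, y t ∈ U)
    (hx : ∀ t ∈ Ico 0 T, HasDerivWithinAt x (g (x t, u t)) (Ico 0 T) t)
    (hy : ∀ t ∈ Ico 0 T, HasDerivWithinAt y (g (y t, u t)) (Ico 0 T) t) :
    EqOn x y (Ico 0 T) := by
  intro s hs
  have hsub : Icc 0 s ⊆ Ico 0 T := fun t ht => ⟨ht.1, ht.2.trans_lt hs.2⟩
  have hxc : ContinuousOn x (Icc 0 s) :=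
    fun t ht => ((hx t (hsub ht)).continuousWithinAt).mono hsub
  have hyc : ContinuousOn y (Icc 0 s) :=
    fun t ht => ((hy t (hsub ht)).continuousWithinAt).mono hsub
  -- For `s < T` both trajectories over `[0, s]` are compact subsets of `U`, so both solve one and
  -- the same globally Lipschitz equation there.
  obtain ⟨h, V, C, L, hC, -, -, hKV, -, hh⟩ := exists_lipschitz_eqOn hU
    ((isCompact_Icc.image_of_continuousOn hxc).union (isCompact_Icc.image_of_continuousOn hyc))
    (union_subset (image_subset_iff.2 fun t ht => hxU t (hsub ht))
      (image_subset_iff.2 fun t ht => hyU t (hsub ht)))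
    (isCompact_Icc.image_of_continuousOn hu) hg
  have hmem : ∀ t ∈ Ico 0 s, Ico 0 T ∈ 𝓝[Ici t] t := fun t ht =>
    mem_of_superset (Ico_mem_nhdsGE (ht.2.trans hs.2)) (Ico_subset_Ico_left ht.1)
  have huB : ∀ t ∈ Ico 0 s, u t ∈ u '' Icc 0 T := fun t ht =>
    mem_image_of_mem u ⟨ht.1, (ht.2.trans hs.2).le⟩
  refine ODE_solution_unique_of_mem_Icc_right (v := fun t x => h (x, u t)) (s := fun _ => univ)
    (K := C) (a := 0) (b := s) (fun t _ => ?_) hxc (fun t ht => ?_) (fun _ _ => mem_univ _) hyc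
    (fun t ht => ?_) (fun _ _ => mem_univ _) hxy (right_mem_Icc.2 hs.1)
  · have := hC.comp (LipschitzWith.prodMk_right (α := E) (u t))
    rw [mul_one] at this
    exact this.lipschitzOnWith
  · rw [hh (x t) (hKV (Or.inl (mem_image_of_mem x (Ico_subset_Icc_self ht)))) _ (huB t ht)]
    exact (hx t (hsub (Ico_subset_Icc_self ht))).mono_of_mem_nhdsWithin (hmem t ht)
  · rw [hh (y t) (hKV (Or.inr (mem_image_of_mem y (Ico_subset_Icc_self ht)))) _ (huB t ht)]
    exact (hy t (hsub (Ico_subset_Icc_self ht))).mono_of_mem_nhdsWithin (hmem t ht)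

/-- Global existence for `x' = g (x, u t)`, given an a-priori bound: all solutions on `[0, s]` end
in a fixed compact subset of the domain of `g`. -/
theorem exists_hasDerivWithinAt_of_apriori {U K : Set E} (hU : IsOpen U) (hK : IsCompact K)
    (hKU : K ⊆ U) {g : E × F → E} (hg : ContDiffOn ℝ 1 g (U ×ˢ univ)) {T : ℝ} (hT : 0 ≤ T)
    {u : ℝ → F} (hu : ContinuousOn u (Icc 0 T)) (x₀ : E)
    (apriori : ∀ s ∈ Icc 0 T, ∀ x : ℝ → E, x 0 = x₀ → (∀ t ∈ Icc 0 s, x t ∈ U) →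
      (∀ t ∈ Icc 0 s, HasDerivWithinAt x (g (x t, u t)) (Icc 0 s) t) → x s ∈ K)
    (hx₀ : x₀ ∈ U) :
    ∃ x : ℝ → E, x 0 = x₀ ∧ (∀ t ∈ Icc 0 T, x t ∈ U) ∧
      ∀ t ∈ Icc 0 T, HasDerivWithinAt x (g (x t, u t)) (Icc 0 T) t := by
  -- The a-priori bound at `s = 0`: on a single point every curve has every derivative.
  replace hx₀ : x₀ ∈ K := by
    refine apriori 0 (left_mem_Icc.2 hT) (fun _ => x₀) rfl (fun _ _ => hx₀) fun t ht => ?_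
    rw [Icc_self] at ht ⊢
    rw [mem_singleton_iff.1 ht]
    exact HasFDerivWithinAt.singleton
  obtain ⟨h, V, C, L, hC, hL, hV, hKV, hVU, hh⟩ := exists_lipschitz_eqOn hU hK hKU
    (isCompact_Icc.image_of_continuousOn hu) hg
  obtain ⟨x, hx0, hx⟩ := exists_hasDerivWithinAt_of_lipschitz hT hu hC hL x₀
  have hxc : ContinuousOn x (Icc 0 T) := fun t ht => (hx t ht).continuousWithinAt
  have hgh : ∀ t ∈ Icc 0 T, x t ∈ V → HasDerivWithinAt x (g (x t, u t)) (Icc 0 T) t :=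
    fun t ht htV => by
      rw [← hh _ htV _ (mem_image_of_mem u ht)]
      exact hx t ht
  have hxV : ∀ t ∈ Icc 0 T, x t ∈ V := by
    by_contra! hcon
    have hne : (Icc 0 T ∩ x ⁻¹' Vᶜ).Nonempty := by
      obtain ⟨t, ht, htV⟩ := hcon
      exact ⟨t, ht, htV⟩
    have hcl : IsClosed (Icc 0 T ∩ x ⁻¹' Vᶜ) :=
      hxc.preimage_isClosed_of_isClosed isClosed_Icc hV.isClosed_compl
    -- At a first exit time `t₁` from `V`, the modified and the true equation agree on `[0, t₁)`, so
    -- the bound puts these states in `K`. As `K` is closed, `x t₁ ∈ K ⊆ V`, a contradiction.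
    obtain ⟨t₁, ⟨ht₁, ht₁V⟩, hmin⟩ :=
      (isCompact_Icc.of_isClosed_subset hcl inter_subset_left).exists_isLeast hne
    have hbefore : ∀ s ∈ Ico 0 t₁, x s ∈ K := by
      intro s hs
      have hsub : Icc 0 s ⊆ Icc 0 T := Icc_subset_Icc_right (hs.2.le.trans ht₁.2)
      have hsV : ∀ t ∈ Icc 0 s, x t ∈ V := fun t ht => by
        by_contra htV
        exact absurd (hmin ⟨hsub ht, htV⟩) (not_le.2 (ht.2.trans_lt hs.2))
      exact apriori s ⟨hs.1, hs.2.le.trans ht₁.2⟩ x hx0 (fun t ht => hVU (hsV t ht))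
        fun t ht => (hgh t (hsub ht) (hsV t ht)).mono hsub
    have ht₁pos : 0 < t₁ := by
      refine lt_of_le_of_ne ht₁.1 fun h0 => ht₁V ?_
      rw [← h0, hx0]
      exact hKV hx₀
    have hcw : ContinuousWithinAt x (Ico 0 t₁) t₁ :=
      (hxc t₁ ht₁).mono fun s hs => ⟨hs.1, hs.2.le.trans ht₁.2⟩
    have hclos : t₁ ∈ closure (Ico 0 t₁) := by
      rw [closure_Ico ht₁pos.ne]
      exact right_mem_Icc.2 ht₁pos.le
    have : x t₁ ∈ closure K := hcw.mem_closure hclos hbefore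
    rw [hK.isClosed.closure_eq] at this
    exact ht₁V (hKV this)
  exact ⟨x, hx0, fun t ht => hVU (hxV t ht), fun t ht => hgh t ht (hxV t ht)⟩

end ODE

/-! ### Bounds for the pressure potential -/

section Potential

variable {M : ℝ} {P : ℝ → ℝ}

theorem PressurePotential.hasDerivAt (hP : PressurePotential M P) {y : ℝ} (hy : y ∈ Ioo 0 M) :
    HasDerivAt P (deriv P y) y :=
  ((hP.contDiff.contDiffAt (isOpen_Ioo.mem_nhds hy)).differentiableAt two_ne_zero).hasDerivAt

theorem PressurePotential.contDiffOn_deriv (hP : PressurePotential M P) :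
    ContDiffOn ℝ 1 (deriv P) (Ioo 0 M) :=
  hP.contDiff.deriv_of_isOpen isOpen_Ioo (by norm_num)

theorem PressurePotential.convexOn (hP : PressurePotential M P) : ConvexOn ℝ (Ioo 0 M) P :=
  convexOn_of_deriv2_nonneg' (convex_Ioo 0 M) (hP.contDiff.differentiableOn two_ne_zero)
    (hP.contDiffOn_deriv.differentiableOn one_ne_zero) fun y hy => (hP.deriv2_pos y hy).le

/-- By convexity the graph lies above its tangent at `M / 2`, which is bounded on the bounded
interval. -/
theorem PressurePotential.exists_lower_bound (hP : PressurePotential M P) (hM : 0 < M) :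
    ∃ B, 0 ≤ B ∧ ∀ y ∈ Ioo 0 M, -B ≤ P y := by
  refine ⟨|P (M / 2)| + |deriv P (M / 2)| * M, by positivity, fun y hy => ?_⟩
  have h2 : M / 2 ∈ Ioo 0 M := ⟨by linarith, by linarith⟩
  have hd := hP.hasDerivAt h2
  have hle : |deriv P (M / 2)| * |y - M / 2| ≤ |deriv P (M / 2)| * M := by
    gcongr
    rw [abs_le]
    constructor <;> linarith [hy.1, hy.2]
  rw [← abs_mul] at hle
  have h3 := neg_abs_le (deriv P (M / 2) * (y - M / 2))
  have h4 := neg_abs_le (P (M / 2))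
  suffices P (M / 2) + deriv P (M / 2) * (y - M / 2) ≤ P y by linarith
  rcases lt_trichotomy y (M / 2) with h | h | h
  · have := hP.convexOn.slope_le_of_hasDerivAt hy h2 h hd
    rw [slope_def_field, div_le_iff₀ (by linarith)] at this
    linarith
  · simp [h]
  · have := hP.convexOn.le_slope_of_hasDerivAt h2 hy h hd
    rw [slope_def_field, le_div_iff₀ (by linarith)] at this
    linarith

/-- This turns an energy bound into a distance of the density from `M`. -/
theorem PressurePotential.exists_upper_bound (hP : PressurePotential M P) (B : ℝ) :
    ∃ b < M, ∀ y ∈ Ioo 0 M, P y ≤ B → y ≤ b := by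
  obtain ⟨b, hb, h⟩ := mem_nhdsLT_iff_exists_Ioo_subset.1 (hP.blowup (Ioi_mem_atTop B))
  refine ⟨b, hb, fun y hy hyB => ?_⟩
  by_contra! hlt
  exact absurd (h ⟨hlt, hy.2⟩) (not_lt.2 hyB)

end Potential

/-! ### Abstract cell systems and their vector field -/

/-- The data of the reduced model after evaluation on the cells: `rv i ρ` is the value of the
density on the cell `i`, `b i` the weighted scalar product over this cell, `κ i` the weighted
measure of the cell, `D` the broken derivative, and `τ` the pairing of boundary data and traces. -/
structure CellSystem (ι Q W F : Type*) [Fintype ι] [NormedAddCommGroup Q] [NormedSpace ℝ Q]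
    [NormedAddCommGroup W] [NormedSpace ℝ W] [NormedAddCommGroup F] [NormedSpace ℝ F] where
  rv : ι → Q →L[ℝ] ℝ
  b : ι → W →L[ℝ] W →L[ℝ] ℝ
  D : W →L[ℝ] Q
  κ : ι → ℝ
  τ : F →L[ℝ] W →L[ℝ] ℝ
  κ_pos : ∀ i, 0 < κ i
  b_symm : ∀ i v w, b i v w = b i w v
  b_nonneg : ∀ i w, 0 ≤ b i w w
  b_definite : ∀ w, (∀ i, b i w w = 0) → w = 0
  inverse_estimate : ∃ C > 0, ∀ i w, (rv i (D w)) ^ 2 ≤ C * b i w w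

namespace CellSystem

variable {ι Q W F : Type*} [Fintype ι] [NormedAddCommGroup Q] [NormedSpace ℝ Q]
    [NormedAddCommGroup W] [NormedSpace ℝ W] [NormedAddCommGroup F] [NormedSpace ℝ F]
    (S : CellSystem ι Q W F) (M : ℝ) (P : ℝ → ℝ)

/-- The states whose density takes its values in `(0, M)`. -/
def domain : Set (Q × W) := {x | ∀ i, S.rv i x.1 ∈ Ioo 0 M}

theorem isOpen_domain : IsOpen (S.domain M) := by
  have : S.domain M = ⋂ i, (fun x : Q × W => S.rv i x.1) ⁻¹' Ioo 0 M := by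
    ext x
    simp [domain]
  rw [this]
  exact isOpen_iInter_of_finite fun i => isOpen_Ioo.preimage (by fun_prop)

/-- The operator `m ↦ ⟨m / ρ, ·⟩_c`. -/
noncomputable def massOp (ρ : Q) : W →L[ℝ] W →L[ℝ] ℝ := ∑ i, (S.rv i ρ)⁻¹ • S.b i

/-- The right hand side of the momentum equation, with the friction law `ρ⁻²`. -/
noncomputable def load (x : Q × W) (v : F) : W →L[ℝ] ℝ :=
  ∑ i, (S.κ i * deriv P (S.rv i x.1) + S.b i x.2 x.2 / (2 * S.rv i x.1 ^ 2)) • (S.rv i ∘L S.D)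
    - ∑ i, (S.rv i x.1 ^ 2)⁻¹ • S.b i x.2 + S.τ v

/-- The vector field of the reduced model. -/
noncomputable def field (z : (Q × W) × F) : Q × W :=
  (-S.D z.1.2, (S.massOp z.1.1).inverse
    (S.load P z.1 z.2 - ∑ i, ((S.rv i z.1.1 ^ 2)⁻¹ * S.rv i (S.D z.1.2)) • S.b i z.1.2))

/-- The energy `⟨m² / (2ρ) + P(ρ), 1⟩_c`. -/
noncomputable def energy (x : Q × W) : ℝ :=
  ∑ i, (S.b i x.2 x.2 / (2 * S.rv i x.1) + S.κ i * P (S.rv i x.1))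

/-- The dissipation `⟨m² / ρ², 1⟩_c`. -/
noncomputable def dissipation (x : Q × W) : ℝ := ∑ i, (S.rv i x.1 ^ 2)⁻¹ * S.b i x.2 x.2

variable {M P}

theorem massOp_apply (ρ : Q) (m w : W) : S.massOp ρ m w = ∑ i, (S.rv i ρ)⁻¹ * S.b i m w := by
  simp [massOp]

theorem load_apply (x : Q × W) (v : F) (w : W) : S.load P x v w =
    ∑ i, (S.κ i * deriv P (S.rv i x.1) + S.b i x.2 x.2 / (2 * S.rv i x.1 ^ 2)) * S.rv i (S.D w)
    - ∑ i, (S.rv i x.1 ^ 2)⁻¹ * S.b i x.2 w + S.τ v w := by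
  simp [load]

/-- Evaluating the functional of `w` at `w` gives a sum of nonnegative terms with positive weights
`1/ρ`, so the kernel is trivial by `b_definite`; equality of dimensions does the rest. -/
theorem massOp_isInvertible [FiniteDimensional ℝ W] {x : Q × W} (hx : x ∈ S.domain M) :
    (S.massOp x.1).IsInvertible := by
  have hinj : Function.Injective (S.massOp x.1 : W →ₗ[ℝ] W →L[ℝ] ℝ) := by
    rw [injective_iff_map_eq_zero]
    intro w hw
    have h0 : ∑ i, (S.rv i x.1)⁻¹ * S.b i w w = 0 := by
      rw [← massOp_apply]
      exact DFunLike.congr_fun hw w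
    rw [Finset.sum_eq_zero_iff_of_nonneg fun i _ =>
      mul_nonneg (inv_nonneg.2 (hx i).1.le) (S.b_nonneg i w)] at h0
    exact S.b_definite w fun i =>
      (mul_eq_zero.1 (h0 i (Finset.mem_univ i))).resolve_left (inv_ne_zero (hx i).1.ne')
  have hrank : Module.finrank ℝ W = Module.finrank ℝ (W →L[ℝ] ℝ) := by
    rw [← (LinearMap.toContinuousLinearMap (𝕜 := ℝ) (E := W) (F' := ℝ)).finrank_eq]
    exact Subspace.dual_finrank_eq.symm
  have : FiniteDimensional ℝ (W →L[ℝ] ℝ) :=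
    (LinearMap.toContinuousLinearMap (𝕜 := ℝ) (E := W) (F' := ℝ)).finiteDimensional
  refine ⟨(LinearMap.linearEquivOfInjective _ hinj hrank).toContinuousLinearEquiv, ?_⟩
  ext w : 1
  rfl

theorem massOp_field [FiniteDimensional ℝ W] {x : Q × W} (hx : x ∈ S.domain M) (v : F) (w : W) :
    ∑ i, (S.rv i x.1)⁻¹ * S.b i (S.field P (x, v)).2 w =
      S.load P x v w - ∑ i, (S.rv i x.1 ^ 2)⁻¹ * S.rv i (S.D x.2) * S.b i x.2 w := by
  rw [← massOp_apply, field, (S.massOp_isInvertible hx).self_apply_inverse]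
  simp

/-- Injectivity of the mass operator means that the momentum balance determines the time derivative
of `m`. This makes every solution of the model a solution of the differential equation. -/
theorem eq_field [FiniteDimensional ℝ W] {x : Q × W} (hx : x ∈ S.domain M) {v : F} {n : W}
    (hn : ∀ w, ∑ i, (S.rv i x.1)⁻¹ * S.b i n w =
      S.load P x v w - ∑ i, (S.rv i x.1 ^ 2)⁻¹ * S.rv i (S.D x.2) * S.b i x.2 w) :
    n = (S.field P (x, v)).2 := by
  refine (S.massOp_isInvertible hx).injective ?_
  ext w
  rw [massOp_apply, massOp_apply, hn, S.massOp_field hx]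

-- The densities are nonzero on the domain, operator inversion is smooth at invertible operators,
-- and `P'` is `C¹` because `P` is `C²`.
set_option maxSynthPendingDepth 3 in
theorem contDiffOn_field [FiniteDimensional ℝ W] (hP : PressurePotential M P) :
    ContDiffOn ℝ 1 (S.field P) (S.domain M ×ˢ univ) := by
  have : CompleteSpace W := FiniteDimensional.complete ℝ W
  intro z hz
  refine ContDiffAt.contDiffWithinAt ?_
  have hrv : ∀ i, ContDiffAt ℝ 1 (fun z : (Q × W) × F => S.rv i z.1.1) z := fun i => by fun_prop
  have hne : ∀ i, S.rv i z.1.1 ≠ 0 := fun i => (hz.1 i).1.ne'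
  have hm : ContDiffAt ℝ 1 (fun z : (Q × W) × F => z.1.2) z := by fun_prop
  have hb : ∀ i, ContDiffAt ℝ 1 (fun z : (Q × W) × F => S.b i z.1.2) z := fun i => by fun_prop
  have hinv : ∀ i, ContDiffAt ℝ 1 (fun z : (Q × W) × F => (S.rv i z.1.1 ^ 2)⁻¹) z :=
    fun i => ((hrv i).pow 2).inv (pow_ne_zero 2 (hne i))
  have hP' : ∀ i, ContDiffAt ℝ 1 (fun z : (Q × W) × F => deriv P (S.rv i z.1.1)) z := fun i =>
    ContDiffAt.comp z (hP.contDiffOn_deriv.contDiffAt (isOpen_Ioo.mem_nhds (hz.1 i))) (hrv i)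
  have hload : ContDiffAt ℝ 1 (fun z : (Q × W) × F => S.load P z.1 z.2) z := by
    refine ((ContDiffAt.sum fun i _ => ?_).sub (ContDiffAt.sum fun i _ => ?_)).add (by fun_prop)
    · refine ((contDiffAt_const.mul (hP' i)).add (((hb i).clm_apply hm).div
        (contDiffAt_const.mul ((hrv i).pow 2)) ?_)).smul contDiffAt_const
      exact mul_ne_zero two_ne_zero (pow_ne_zero 2 (hne i))
    · exact (hinv i).smul (hb i)
  have hmass : ContDiffAt ℝ 1 (fun z : (Q × W) × F => S.massOp z.1.1) z := by
    refine ContDiffAt.sum fun i _ => ?_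
    exact ((hrv i).inv (hne i)).smul contDiffAt_const
  have hrhs : ContDiffAt ℝ 1 (fun z : (Q × W) × F => S.load P z.1 z.2 -
      ∑ i, ((S.rv i z.1.1 ^ 2)⁻¹ * S.rv i (S.D z.1.2)) • S.b i z.1.2) z :=
    hload.sub (ContDiffAt.sum fun i _ => ((hinv i).mul (by fun_prop)).smul (hb i))
  have hD : ContDiffAt ℝ 1 (fun z : (Q × W) × F => -S.D z.1.2) z := by fun_prop
  have hinverse : ContDiffAt ℝ 1 (fun z : (Q × W) × F => (S.massOp z.1.1).inverse) z :=
    (S.massOp_isInvertible hz.1).contDiffAt_map_inverse.comp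
      (f := fun z : (Q × W) × F => S.massOp z.1.1) z hmass
  exact hD.prodMk (hinverse.clm_apply hrhs)

end CellSystem

/-! ### Energy identity and dissipation estimates -/

namespace CellSystem

variable {ι Q W F : Type*} [Fintype ι] [NormedAddCommGroup Q] [NormedSpace ℝ Q]
    [NormedAddCommGroup W] [NormedSpace ℝ W] [NormedAddCommGroup F] [NormedSpace ℝ F]
    (S : CellSystem ι Q W F) {M : ℝ} {P : ℝ → ℝ} {x : ℝ → Q × W} {z : Q × W} {s : Set ℝ} {t : ℝ}

theorem hasDerivWithinAt_rv (hx : HasDerivWithinAt x z s t) (i : ι) :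
    HasDerivWithinAt (fun t => S.rv i (x t).1) (S.rv i z.1) s t :=
  (S.rv i ∘L ContinuousLinearMap.fst ℝ Q W).hasFDerivAt.comp_hasDerivWithinAt t hx

theorem hasDerivWithinAt_b (hx : HasDerivWithinAt x z s t) (i : ι) (w : W) :
    HasDerivWithinAt (fun t => S.b i (x t).2 w) (S.b i z.2 w) s t :=
  ((S.b i).flip w ∘L ContinuousLinearMap.snd ℝ Q W).hasFDerivAt.comp_hasDerivWithinAt t hx

theorem hasDerivWithinAt_b_self (hx : HasDerivWithinAt x z s t) (i : ι) :
    HasDerivWithinAt (fun t => S.b i (x t).2 (x t).2) (2 * S.b i z.2 (x t).2) s t := by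
  have h2 : HasDerivWithinAt (fun t => (x t).2) z.2 s t :=
    (ContinuousLinearMap.snd ℝ Q W).hasFDerivAt.comp_hasDerivWithinAt t hx
  have h := (((S.b i).hasFDerivAt.comp_hasDerivWithinAt t h2)).clm_apply h2
  refine h.congr_deriv ?_
  simp only [Function.comp_apply]
  rw [S.b_symm i (x t).2 z.2]
  ring

/-- Stated for an arbitrary velocity `z`, so that it serves both to derive the differential equation
from the model and to recover the model from it. -/
theorem hasDerivWithinAt_momentum (hx : HasDerivWithinAt x z s t) (ht : x t ∈ S.domain M) (w : W) :
    HasDerivWithinAt (fun t => ∑ i, (S.rv i (x t).1)⁻¹ * S.b i (x t).2 w)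
      (∑ i, (S.rv i (x t).1)⁻¹ * S.b i z.2 w
        - ∑ i, (S.rv i (x t).1 ^ 2)⁻¹ * S.rv i z.1 * S.b i (x t).2 w) s t := by
  rw [← Finset.sum_sub_distrib]
  refine HasDerivWithinAt.fun_sum fun i _ => ?_
  refine (((S.hasDerivWithinAt_rv hx i).fun_inv (ht i).1.ne').fun_mul
    (S.hasDerivWithinAt_b hx i w)).congr_deriv ?_
  ring

theorem dissipation_nonneg (x : Q × W) : 0 ≤ S.dissipation x :=
  Finset.sum_nonneg fun i _ => mul_nonneg (by positivity) (S.b_nonneg i _)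

/-- The relative change of the density is controlled by the dissipation. -/
theorem exists_neg_rv_div_le : ∃ c, 0 ≤ c ∧ ∀ x ∈ S.domain M, ∀ i,
    S.rv i (S.D x.2) / S.rv i x.1 ≤ S.dissipation x / 2 + c := by
  obtain ⟨C, hC, hle⟩ := S.inverse_estimate
  refine ⟨C / 2, by positivity, fun x hx i => ?_⟩
  have h1 : (S.rv i x.1 ^ 2)⁻¹ * S.b i x.2 x.2 ≤ S.dissipation x :=
    Finset.single_le_sum (f := fun i => (S.rv i x.1 ^ 2)⁻¹ * S.b i x.2 x.2)
      (fun i _ => mul_nonneg (by positivity) (S.b_nonneg i _)) (Finset.mem_univ i)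
  have h2 : (S.rv i (S.D x.2) / S.rv i x.1) ^ 2 ≤ C * S.dissipation x := by
    rw [div_pow, div_eq_inv_mul]
    calc (S.rv i x.1 ^ 2)⁻¹ * S.rv i (S.D x.2) ^ 2
        ≤ (S.rv i x.1 ^ 2)⁻¹ * (C * S.b i x.2 x.2) := by gcongr; exact hle i x.2
      _ = C * ((S.rv i x.1 ^ 2)⁻¹ * S.b i x.2 x.2) := by ring
      _ ≤ C * S.dissipation x := by gcongr
  generalize S.rv i (S.D x.2) / S.rv i x.1 = y at h2
  -- Young's inequality `y ≤ y² / (2C) + C / 2`, weighted to consume exactly half of the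
  -- dissipation, the half which the boundary supply leaves over.
  have h3 : 0 ≤ (y - C) ^ 2 / C / 2 := by positivity
  have h4 : (y - C) ^ 2 / C / 2 = y ^ 2 / C / 2 - y + C / 2 := by
    field_simp
    ring
  have h5 : y ^ 2 / C ≤ S.dissipation x := by
    rw [div_le_iff₀ hC]
    linarith
  linarith

variable [FiniteDimensional ℝ W]

/-- Energy identity. -/
theorem hasDerivWithinAt_energy (hP : PressurePotential M P) {v : F} (ht : x t ∈ S.domain M)
    (hx : HasDerivWithinAt x (S.field P (x t, v)) s t) :
    HasDerivWithinAt (fun t => S.energy P (x t)) (-S.dissipation (x t) + S.τ v (x t).2) s t := by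
  have key : HasDerivWithinAt (fun t => S.energy P (x t))
      (∑ i, ((2 * S.b i (S.field P (x t, v)).2 (x t).2 * (2 * S.rv i (x t).1)
        - S.b i (x t).2 (x t).2 * (2 * S.rv i (-S.D (x t).2))) / (2 * S.rv i (x t).1) ^ 2
        + S.κ i * (deriv P (S.rv i (x t).1) * S.rv i (-S.D (x t).2)))) s t :=
    HasDerivWithinAt.fun_sum fun i _ =>
      ((S.hasDerivWithinAt_b_self hx i).fun_div ((S.hasDerivWithinAt_rv hx i).const_mul 2)
        (mul_ne_zero two_ne_zero (ht i).1.ne')).add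
      (((hP.hasDerivAt (ht i)).comp_hasDerivWithinAt t (S.hasDerivWithinAt_rv hx i)).const_mul _)
  refine key.congr_deriv ?_
  have hm := S.massOp_field (P := P) ht v (x t).2
  rw [load_apply] at hm
  -- The mass equation replaces the time derivative of `ρ` by `-D m`. After inserting
  -- `massOp_field`, the pressure and convective terms cancel and only friction and boundary supply
  -- remain.
  have hsplit : ∑ i, ((2 * S.b i (S.field P (x t, v)).2 (x t).2 * (2 * S.rv i (x t).1)
        - S.b i (x t).2 (x t).2 * (2 * S.rv i (-S.D (x t).2))) / (2 * S.rv i (x t).1) ^ 2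
        + S.κ i * (deriv P (S.rv i (x t).1) * S.rv i (-S.D (x t).2))) =
      ∑ i, (S.rv i (x t).1)⁻¹ * S.b i (S.field P (x t, v)).2 (x t).2
      + ∑ i, (S.rv i (x t).1 ^ 2)⁻¹ * S.rv i (S.D (x t).2) * S.b i (x t).2 (x t).2
      - ∑ i, (S.κ i * deriv P (S.rv i (x t).1)
        + S.b i (x t).2 (x t).2 / (2 * S.rv i (x t).1 ^ 2)) * S.rv i (S.D (x t).2) := by
    rw [← Finset.sum_add_distrib, ← Finset.sum_sub_distrib]
    refine Finset.sum_congr rfl fun i _ => ?_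
    have := (ht i).1.ne'
    rw [map_neg]
    field_simp
    ring
  rw [hsplit, hm, dissipation]
  ring

/-- The form is positive on the unit sphere of `W`, hence bounded below there by compactness;
homogeneity extends this to all of `W`. An empty sphere means `W = 0`. -/
theorem exists_norm_sq_le : ∃ γ > 0, ∀ w, ‖w‖ ^ 2 ≤ γ * ∑ i, S.b i w w := by
  have : ProperSpace W := FiniteDimensional.proper ℝ W
  have hcont : Continuous fun w => ∑ i, S.b i w w := by fun_prop
  have hnn : ∀ w, 0 ≤ ∑ i, S.b i w w := fun w => Finset.sum_nonneg fun i _ => S.b_nonneg i w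
  obtain hempty | hne := (Metric.sphere (0 : W) 1).eq_empty_or_nonempty
  · refine ⟨1, one_pos, fun w => ?_⟩
    have hw : w = 0 := by
      by_contra hw
      have : ‖w‖⁻¹ • w ∈ Metric.sphere (0 : W) 1 := by
        simp [norm_smul, norm_ne_zero_iff.2 hw]
      rw [hempty] at this
      exact this
    simp [hw]
  · obtain ⟨w₀, hw₀, hmin⟩ := (isCompact_sphere (0 : W) 1).exists_isMinOn hne hcont.continuousOn
    have hpos : 0 < ∑ i, S.b i w₀ w₀ := by
      refine lt_of_le_of_ne (hnn w₀) fun h0 => ?_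
      have := (Finset.sum_eq_zero_iff_of_nonneg fun i _ => S.b_nonneg i w₀).1 h0.symm
      have hz := S.b_definite w₀ fun i => this i (Finset.mem_univ i)
      simp [hz] at hw₀
    refine ⟨(∑ i, S.b i w₀ w₀)⁻¹, inv_pos.2 hpos, fun w => ?_⟩
    by_cases hw : w = 0
    · simp [hw]
    have hn : ‖w‖ ≠ 0 := norm_ne_zero_iff.2 hw
    have hmem : ‖w‖⁻¹ • w ∈ Metric.sphere (0 : W) 1 := by simp [norm_smul, hn]
    have h := isMinOn_iff.1 hmin _ hmem
    simp only [map_smul, smul_apply, smul_eq_mul, ← Finset.mul_sum] at h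
    rw [inv_mul_eq_div, le_div_iff₀ hpos]
    calc ‖w‖ ^ 2 * ∑ i, S.b i w₀ w₀
        ≤ ‖w‖ ^ 2 * (‖w‖⁻¹ * (‖w‖⁻¹ * ∑ i, S.b i w w)) := by gcongr
      _ = ∑ i, S.b i w w := by field_simp

/-- The supply through the boundary is controlled by the dissipation. -/
theorem exists_supply_le (hM : 0 < M) (β : ℝ) : ∃ c, 0 ≤ c ∧ ∀ x ∈ S.domain M, ∀ v, ‖S.τ v‖ ≤ β →
    -S.dissipation x + S.τ v x.2 ≤ -(S.dissipation x / 2) + c := by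
  obtain ⟨γ, hγ, hle⟩ := S.exists_norm_sq_le
  have hG : 0 < γ * M ^ 2 := by positivity
  refine ⟨β ^ 2 * (γ * M ^ 2) / 2, by positivity, fun x hx v hv => ?_⟩
  -- Here `ρ < M` enters, as `1 ≤ M² / ρ²`.
  have h1 : ∑ i, S.b i x.2 x.2 ≤ M ^ 2 * S.dissipation x := by
    rw [dissipation, Finset.mul_sum]
    refine Finset.sum_le_sum fun i _ => ?_
    have hi := hx i
    rw [← mul_assoc]
    refine le_mul_of_one_le_left (S.b_nonneg i _) ?_
    rw [← div_eq_mul_inv, one_le_div (pow_pos hi.1 2)]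
    exact pow_le_pow_left₀ hi.1.le hi.2.le 2
  have h2 : ‖x.2‖ ^ 2 ≤ γ * M ^ 2 * S.dissipation x := by
    rw [mul_assoc]
    exact (hle x.2).trans (mul_le_mul_of_nonneg_left h1 hγ.le)
  have h3 : S.τ v x.2 ≤ β * ‖x.2‖ :=
    (le_abs_self _).trans (((S.τ v).le_opNorm x.2).trans (by gcongr))
  have h4 : ‖x.2‖ ^ 2 / (γ * M ^ 2) ≤ S.dissipation x := by
    rw [div_le_iff₀ hG]
    linarith
  -- Young's inequality with weight `γ * M ^ 2`, so that the quadratic term is at most `D / 2` by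
  -- `h4`.
  have h5 : β * ‖x.2‖ ≤ β ^ 2 * (γ * M ^ 2) / 2 + ‖x.2‖ ^ 2 / (γ * M ^ 2) / 2 := by
    have h6 : 0 ≤ (β * (γ * M ^ 2) - ‖x.2‖) ^ 2 / (γ * M ^ 2) / 2 := by positivity
    have h7 : (β * (γ * M ^ 2) - ‖x.2‖) ^ 2 / (γ * M ^ 2) / 2 =
        β ^ 2 * (γ * M ^ 2) / 2 + ‖x.2‖ ^ 2 / (γ * M ^ 2) / 2 - β * ‖x.2‖ := by
      field_simp
      ring
    linarith
  linarith

end CellSystem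

/-! ### A-priori bounds and well-posedness of cell systems -/

namespace CellSystem

variable {ι Q W F : Type*} [Fintype ι] [NormedAddCommGroup Q] [NormedSpace ℝ Q]
    [NormedAddCommGroup W] [NormedSpace ℝ W] [NormedAddCommGroup F] [NormedSpace ℝ F]
    (S : CellSystem ι Q W F) {M : ℝ} {P : ℝ → ℝ} [FiniteDimensional ℝ W]

theorem energy_le_add (hP : PressurePotential M P) {s c : ℝ} {u : ℝ → F} {x : ℝ → Q × W}
    (hxU : ∀ t ∈ Icc 0 s, x t ∈ S.domain M)
    (hx : ∀ t ∈ Icc 0 s, HasDerivWithinAt x (S.field P (x t, u t)) (Icc 0 s) t)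
    (hc : ∀ t ∈ Icc 0 s, -S.dissipation (x t) + S.τ (u t) (x t).2 ≤
      -(S.dissipation (x t) / 2) + c) {t : ℝ} (ht : t ∈ Icc 0 s) :
    S.energy P (x t) ≤ S.energy P (x 0) + c * t := by
  have hd : ∀ t ∈ Icc 0 s, HasDerivWithinAt (fun t => S.energy P (x t) - c * t)
      (-S.dissipation (x t) + S.τ (u t) (x t).2 - c * 1) (Icc 0 s) t := fun t ht =>
    (S.hasDerivWithinAt_energy hP (hxU t ht) (hx t ht)).sub
      ((hasDerivWithinAt_id t _).const_mul c)
  have hanti := antitoneOn_of_hasDerivWithinAt_nonpos (convex_Icc 0 s)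
    (fun t ht => (hd t ht).continuousWithinAt)
    (fun t ht => (hd t (interior_subset ht)).mono interior_subset) fun t ht => by
      linarith [hc t (interior_subset ht), S.dissipation_nonneg (x t)]
  have := hanti (left_mem_Icc.2 (ht.1.trans ht.2)) ht ht.1
  simp only at this
  linarith

/-- The logarithm of the density decreases at rate at most `D/2 + c'`, while the energy decreases at
rate at least `D/2 - c`. In the difference the dissipation, for which no pointwise bound in time is
at hand, drops out. -/
theorem log_sub_energy_le (hP : PressurePotential M P) {s c c' : ℝ} {u : ℝ → F} {x : ℝ → Q × W}
    (hxU : ∀ t ∈ Icc 0 s, x t ∈ S.domain M)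
    (hx : ∀ t ∈ Icc 0 s, HasDerivWithinAt x (S.field P (x t, u t)) (Icc 0 s) t)
    (hc : ∀ t ∈ Icc 0 s, -S.dissipation (x t) + S.τ (u t) (x t).2 ≤
      -(S.dissipation (x t) / 2) + c)
    (hc' : ∀ t ∈ Icc 0 s, ∀ i, S.rv i (S.D (x t).2) / S.rv i (x t).1 ≤
      S.dissipation (x t) / 2 + c') (i : ι) {t : ℝ} (ht : t ∈ Icc 0 s) :
    Real.log (S.rv i (x 0).1) - S.energy P (x 0) ≤
      Real.log (S.rv i (x t).1) - S.energy P (x t) + (c + c') * t := by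
  have hd : ∀ t ∈ Icc 0 s, HasDerivWithinAt
      (fun t => Real.log (S.rv i (x t).1) - S.energy P (x t) + (c + c') * t)
      (S.rv i (-S.D (x t).2) / S.rv i (x t).1 - (-S.dissipation (x t) + S.τ (u t) (x t).2)
        + (c + c') * 1) (Icc 0 s) t := fun t ht =>
    (((S.hasDerivWithinAt_rv (hx t ht) i).log (hxU t ht i).1.ne').sub
      (S.hasDerivWithinAt_energy hP (hxU t ht) (hx t ht))).add
      ((hasDerivWithinAt_id t _).const_mul (c + c'))
  have hmono := monotoneOn_of_hasDerivWithinAt_nonneg (convex_Icc 0 s)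
    (fun t ht => (hd t ht).continuousWithinAt)
    (fun t ht => (hd t (interior_subset ht)).mono interior_subset) fun t ht => by
      have h1 := hc t (interior_subset ht)
      have h2 := hc' t (interior_subset ht) i
      rw [map_neg, neg_div]
      linarith
  have := hmono (left_mem_Icc.2 (ht.1.trans ht.2)) ht ht.1
  simp only [mul_zero, add_zero] at this
  exact this

/-- Bounds on the state in terms of its energy. -/
theorem exists_bounds_of_energy_le (hP : PressurePotential M P) (hM : 0 < M) (Λ : ℝ) :
    ∃ (H R : ℝ) (ρmax : ι → ℝ), 0 ≤ R ∧ (∀ i, ρmax i < M) ∧ ∀ x ∈ S.domain M,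
      H ≤ S.energy P x ∧ (S.energy P x ≤ Λ → ‖x.2‖ ≤ R ∧ ∀ i, S.rv i x.1 ≤ ρmax i) := by
  obtain ⟨B, hB, hPB⟩ := hP.exists_lower_bound hM
  obtain ⟨γ, hγ, hle⟩ := S.exists_norm_sq_le
  -- Shifting `P` by its lower bound `B` makes all summands of the energy nonnegative, so each of
  -- them is bounded by `Λ'` separately.
  set Λ' := Λ + B * ∑ i, S.κ i with hΛ'
  choose ρmax hρM hρ using fun i => hP.exists_upper_bound (Λ' / S.κ i - B)
  refine ⟨-(B * ∑ i, S.κ i), √(γ * (2 * M * Λ')), ρmax, Real.sqrt_nonneg _, hρM,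
    fun x hx => ?_⟩
  have hk : ∀ i, 0 ≤ S.b i x.2 x.2 / (2 * S.rv i x.1) := fun i =>
    div_nonneg (S.b_nonneg i _) (mul_nonneg two_pos.le (hx i).1.le)
  have hp : ∀ i, 0 ≤ S.κ i * (P (S.rv i x.1) + B) := fun i =>
    mul_nonneg (S.κ_pos i).le (by linarith [hPB _ (hx i)])
  have hen : S.energy P x + B * ∑ i, S.κ i =
      ∑ i, (S.b i x.2 x.2 / (2 * S.rv i x.1) + S.κ i * (P (S.rv i x.1) + B)) := by
    rw [energy, Finset.mul_sum, ← Finset.sum_add_distrib]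
    exact Finset.sum_congr rfl fun i _ => by ring
  refine ⟨?_, fun hΛ => ⟨?_, fun i => ?_⟩⟩
  · have : 0 ≤ S.energy P x + B * ∑ i, S.κ i := by
      rw [hen]
      exact Finset.sum_nonneg fun i _ => add_nonneg (hk i) (hp i)
    linarith
  · refine Real.le_sqrt_of_sq_le ((hle x.2).trans (mul_le_mul_of_nonneg_left ?_ hγ.le))
    have h1 : ∑ i, S.b i x.2 x.2 / (2 * S.rv i x.1) ≤ Λ' := by
      have : ∑ i, S.b i x.2 x.2 / (2 * S.rv i x.1) ≤ S.energy P x + B * ∑ i, S.κ i := by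
        rw [hen]
        exact Finset.sum_le_sum fun i _ => le_add_of_nonneg_right (hp i)
      linarith
    refine le_trans ?_ (mul_le_mul_of_nonneg_left h1 (by positivity))
    rw [Finset.mul_sum]
    refine Finset.sum_le_sum fun i _ => ?_
    have hi := hx i
    rw [mul_div_assoc', le_div_iff₀ (by linarith [hi.1])]
    nlinarith [S.b_nonneg i x.2, hi.2]
  · refine hρ i _ (hx i) ?_
    have h1 : S.κ i * (P (S.rv i x.1) + B) ≤ Λ' := by
      have : S.b i x.2 x.2 / (2 * S.rv i x.1) + S.κ i * (P (S.rv i x.1) + B)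
          ≤ S.energy P x + B * ∑ i, S.κ i := by
        rw [hen]
        exact Finset.single_le_sum
          (f := fun i => S.b i x.2 x.2 / (2 * S.rv i x.1) + S.κ i * (P (S.rv i x.1) + B))
          (fun i _ => add_nonneg (hk i) (hp i)) (Finset.mem_univ i)
      linarith [hk i]
    rw [le_sub_iff_add_le, le_div_iff₀ (S.κ_pos i)]
    linarith

/-- Solutions of the reduced model, written in terms of the cell data. -/
structure IsSolution (M : ℝ) (P : ℝ → ℝ) (T : ℝ) (u : ℝ → F) (x₀ : Q × W) (x : ℝ → Q × W) :
    Prop where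
  contDiff : ContDiffOn ℝ 1 x (Ico 0 T)
  init : x 0 = x₀
  mem_domain : ∀ t ∈ Ico 0 T, x t ∈ S.domain M
  mass : ∀ t ∈ Ico 0 T, (derivWithin x (Ico 0 T) t).1 = -S.D (x t).2
  momentum : ∀ t ∈ Ico 0 T, ∀ w,
    HasDerivWithinAt (fun s => ∑ i, (S.rv i (x s).1)⁻¹ * S.b i (x s).2 w)
      (S.load P (x t) (u t) w) (Ico 0 T) t

variable {S}

/-- The product rule and the momentum equation give two derivatives of the same function; they
coincide because derivatives within `[0, T)` are unique. -/
theorem IsSolution.hasDerivWithinAt {T : ℝ} {u : ℝ → F} {x₀ : Q × W} {x : ℝ → Q × W}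
    (hx : S.IsSolution M P T u x₀ x) {t : ℝ} (ht : t ∈ Ico 0 T) :
    HasDerivWithinAt x (S.field P (x t, u t)) (Ico 0 T) t := by
  have hd : HasDerivWithinAt x (derivWithin x (Ico 0 T) t) (Ico 0 T) t :=
    (hx.contDiff.differentiableOn one_ne_zero t ht).hasDerivWithinAt
  have huniq : UniqueDiffWithinAt ℝ (Ico 0 T) t := uniqueDiffOn_Ico 0 T t ht
  refine hd.congr_deriv (Prod.ext (hx.mass t ht) ?_)
  refine S.eq_field (hx.mem_domain t ht) fun w => ?_
  have h1 := huniq.eq_deriv _ (S.hasDerivWithinAt_momentum hd (hx.mem_domain t ht) w)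
    (hx.momentum t ht w)
  rw [hx.mass t ht] at h1
  simp only [map_neg, mul_neg, neg_mul, Finset.sum_neg_distrib] at h1
  linarith

variable (S) [FiniteDimensional ℝ Q]

/-- A-priori bound: solutions up to time `T` stay in a compact set of states. -/
theorem exists_isCompact_apriori (hP : PressurePotential M P) (hM : 0 < M) {T : ℝ} {u : ℝ → F}
    (hu : ContinuousOn u (Icc 0 T)) (x₀ : Q × W) :
    ∃ K : Set (Q × W), IsCompact K ∧ K ⊆ S.domain M ∧
      ∀ s ∈ Icc 0 T, ∀ x : ℝ → Q × W, x 0 = x₀ → (∀ t ∈ Icc 0 s, x t ∈ S.domain M) →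
        (∀ t ∈ Icc 0 s, HasDerivWithinAt x (S.field P (x t, u t)) (Icc 0 s) t) → x s ∈ K := by
  have : ProperSpace W := FiniteDimensional.proper ℝ W
  have : ProperSpace Q := FiniteDimensional.proper ℝ Q
  obtain ⟨β, hβ⟩ := isCompact_Icc.exists_bound_of_continuousOn
    (S.τ.continuous.comp_continuousOn hu)
  obtain ⟨c, hc0, hc⟩ := S.exists_supply_le hM β
  obtain ⟨c', hc'0, hc'⟩ := S.exists_neg_rv_div_le (M := M)
  obtain ⟨H, R, ρmax, hR, hρM, hbd⟩ := S.exists_bounds_of_energy_le hP hM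
    (S.energy P x₀ + c * T)
  -- The lower bound of `log_sub_energy_le` at time `T`, with the energy replaced by its lower bound
  -- `H`.
  set ρmin : ι → ℝ := fun i =>
    Real.exp (Real.log (S.rv i x₀.1) - S.energy P x₀ + H - (c + c') * T)
  -- The functionals `rv i` are not assumed to separate points of `Q`, so boundedness of `ρ` is
  -- obtained by integrating `ρ' = -D m` with `‖m‖ ≤ R`.
  refine ⟨(Metric.closedBall x₀.1 (‖S.D‖ * R * T) ×ˢ Metric.closedBall 0 R) ∩
    ⋂ i, (fun x : Q × W => S.rv i x.1) ⁻¹' Icc (ρmin i) (ρmax i), ?_, ?_, ?_⟩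
  · refine IsCompact.inter_right ((isCompact_closedBall _ _).prod (isCompact_closedBall _ _)) ?_
    exact isClosed_iInter fun i => isClosed_Icc.preimage (by fun_prop)
  · intro x hx i
    have := mem_iInter.1 hx.2 i
    exact ⟨(Real.exp_pos _).trans_le this.1, this.2.trans_lt (hρM i)⟩
  · intro s hs x hx0 hxU hx
    have hsub : ∀ {t}, t ∈ Icc 0 s → t ∈ Icc 0 T := fun ht => ⟨ht.1, ht.2.trans hs.2⟩
    have hcx : ∀ t ∈ Icc 0 s, -S.dissipation (x t) + S.τ (u t) (x t).2 ≤
        -(S.dissipation (x t) / 2) + c := fun t ht => hc _ (hxU t ht) _ (hβ t (hsub ht))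
    have hbdx : ∀ t ∈ Icc 0 s, ‖(x t).2‖ ≤ R ∧ ∀ i, S.rv i (x t).1 ≤ ρmax i := by
      intro t ht
      refine (hbd _ (hxU t ht)).2 ((S.energy_le_add hP hxU hx hcx ht).trans ?_)
      rw [hx0]
      gcongr
      exact (hsub ht).2
    have hss : s ∈ Icc 0 s := right_mem_Icc.2 hs.1
    refine ⟨⟨?_, ?_⟩, mem_iInter.2 fun i => ⟨?_, (hbdx s hss).2 i⟩⟩
    · have h1 : ∀ t ∈ Icc 0 s, HasDerivWithinAt (fun t => (x t).1) (-S.D (x t).2) (Icc 0 s) t :=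
        fun t ht =>
          (ContinuousLinearMap.fst ℝ Q W).hasFDerivAt.comp_hasDerivWithinAt t (hx t ht)
      have h2 := (convex_Icc 0 s).norm_image_sub_le_of_norm_hasDerivWithin_le h1
        (C := ‖S.D‖ * R) (fun t ht => ?_) (left_mem_Icc.2 hs.1) hss
      · rw [mem_closedBall_iff_norm, ← hx0]
        refine h2.trans ?_
        rw [sub_zero, Real.norm_eq_abs, abs_of_nonneg hs.1]
        gcongr
        exact hs.2
      · rw [norm_neg]
        exact (S.D.le_opNorm _).trans (by gcongr; exact (hbdx t ht).1)
    · rw [mem_closedBall_zero_iff]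
      exact (hbdx s hss).1
    · have hi := (hxU s hss i).1
      have h1 := S.log_sub_energy_le hP hxU hx hcx (fun t ht => hc' _ (hxU t ht)) i hss
      have h2 := (hbd _ (hxU s hss)).1
      rw [hx0] at h1
      have h3 : (c + c') * s ≤ (c + c') * T := by
        gcongr
        exact hs.2
      simp only [ρmin]
      rw [← Real.le_log_iff_exp_le hi]
      linarith

theorem existsUnique_solution [FiniteDimensional ℝ F] (hP : PressurePotential M P) (hM : 0 < M)
    {T : ℝ} (hT : 0 < T) {u : ℝ → F} (hu : ContinuousOn u (Icc 0 T)) {x₀ : Q × W}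
    (hx₀ : x₀ ∈ S.domain M) :
    (∃ x, S.IsSolution M P T u x₀ x) ∧ ∀ x y, S.IsSolution M P T u x₀ x →
      S.IsSolution M P T u x₀ y → EqOn x y (Ico 0 T) := by
  have hfield := S.contDiffOn_field hP
  refine ⟨?_, fun x y hx hy => eqOn_of_hasDerivWithinAt (S.isOpen_domain M) hfield hu
    (hx.init.trans hy.init.symm) hx.mem_domain hy.mem_domain (fun t ht => hx.hasDerivWithinAt ht)
    fun t ht => hy.hasDerivWithinAt ht⟩
  obtain ⟨K, hK, hKU, hap⟩ := S.exists_isCompact_apriori hP hM hu x₀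
  obtain ⟨x, hx0, hxU, hx⟩ := exists_hasDerivWithinAt_of_apriori (S.isOpen_domain M) hK hKU
    hfield hT.le hu x₀ hap hx₀
  have hsub : Ico 0 T ⊆ Icc 0 T := Ico_subset_Icc_self
  have hd : ∀ t ∈ Ico 0 T, HasDerivWithinAt x (S.field P (x t, u t)) (Ico 0 T) t :=
    fun t ht => (hx t (hsub ht)).mono hsub
  have hdw : ∀ t ∈ Ico 0 T, derivWithin x (Ico 0 T) t = S.field P (x t, u t) :=
    fun t ht => (hd t ht).derivWithin (uniqueDiffOn_Ico 0 T t ht)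
  refine ⟨x, ?_, hx0, fun t ht => hxU t (hsub ht), fun t ht => ?_, fun t ht w => ?_⟩
  · rw [contDiffOn_one_iff_derivWithin (uniqueDiffOn_Ico 0 T)]
    refine ⟨fun t ht => (hd t ht).differentiableWithinAt, ContinuousOn.congr ?_ hdw⟩
    exact hfield.continuousOn.comp (ContinuousOn.prodMk (fun t ht => (hd t ht).continuousWithinAt)
      (hu.mono hsub)) fun t ht => ⟨hxU t (hsub ht), mem_univ _⟩
  · rw [hdw t ht]
    rfl
  · refine (S.hasDerivWithinAt_momentum (hd t ht) (hxU t (hsub ht)) w).congr_deriv ?_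
    rw [S.massOp_field (hxU t (hsub ht))]
    simp [field]

end CellSystem

/-! ### Weak derivatives, scalar products and traces on the network -/

variable {V E J : Type*}

namespace Network

variable (N : Network V E)

theorem ev_add (v w : N.Cont) (e : E) (y : ℝ) : N.ev (v + w) e y = N.ev v e y + N.ev w e y := rfl

theorem ev_smul (c : ℝ) (w : N.Cont) (e : E) (y : ℝ) : N.ev (c • w) e y = c * N.ev w e y := rfl

theorem continuous_ev (w : N.Cont) (e : E) : Continuous (N.ev w e) := (w e).continuous.Icc_extend'

theorem eq_zero_of_ev_eq_zero {w : N.Cont} (h : ∀ e, ∀ y ∈ Icc 0 (N.len e), N.ev w e y = 0) :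
    w = 0 := by
  funext e
  ext y
  have := h e y y.2
  rwa [ev, IccExtend_of_mem _ _ y.2] at this

theorem integrableOn_ev_mul (w : N.Cont) (e : E) {f : ℝ → ℝ} (hf : Continuous f) (a b : ℝ) :
    IntegrableOn (fun y => N.ev w e y * f y) (Icc a b) :=
  ((N.continuous_ev w e).mul hf).continuousOn.integrableOn_Icc

theorem integrableOn_fn_mul (g : N.L2) (e : E) {f : ℝ → ℝ} (hf : Continuous f)
    (hf' : HasCompactSupport f) : IntegrableOn (fun y => N.fn g e y * f y) (Ioo 0 (N.len e)) := by
  obtain ⟨C, hC⟩ := hf'.exists_bound_of_continuous hf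
  have hg : Integrable (N.fn g e) (volume.restrict (Ioo 0 (N.len e))) :=
    (Lp.memLp (g e)).integrable (by norm_num)
  exact hg.mul_bdd (c := C) hf.aestronglyMeasurable (Eventually.of_forall hC)

theorem fn_add (p q : N.L2) (e : E) :
    ∀ᵐ y ∂(volume.restrict (Ioo 0 (N.len e))), N.fn (p + q) e y = N.fn p e y + N.fn q e y :=
  Lp.coeFn_add (p e) (q e)

theorem fn_smul (c : ℝ) (q : N.L2) (e : E) :
    ∀ᵐ y ∂(volume.restrict (Ioo 0 (N.len e))), N.fn (c • q) e y = c * N.fn q e y :=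
  Lp.coeFn_smul c (q e)

variable {N}

theorem HasWeakDeriv.add {v w : N.Cont} {g h : N.L2} (hg : N.HasWeakDeriv v g)
    (hh : N.HasWeakDeriv w h) : N.HasWeakDeriv (v + w) (g + h) := by
  intro e φ h1 h2 h3
  have hd : Continuous (deriv φ) := h1.continuous_deriv (by simp)
  have e1 : ∫ y in Ioo 0 (N.len e), N.fn (g + h) e y * φ y =
      ∫ y in Ioo 0 (N.len e), (N.fn g e y * φ y + N.fn h e y * φ y) := by
    refine integral_congr_ae ?_
    filter_upwards [N.fn_add g h e] with y hy
    rw [hy, add_mul]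
  rw [e1, integral_add (N.integrableOn_fn_mul g e h1.continuous h2)
    (N.integrableOn_fn_mul h e h1.continuous h2), neg_add, ← hg e φ h1 h2 h3, ← hh e φ h1 h2 h3,
    ← integral_add ((N.integrableOn_ev_mul v e hd _ _).mono_set Ioo_subset_Icc_self)
      ((N.integrableOn_ev_mul w e hd _ _).mono_set Ioo_subset_Icc_self)]
  simp only [ev_add, add_mul]

theorem HasWeakDeriv.smul (c : ℝ) {w : N.Cont} {g : N.L2} (hg : N.HasWeakDeriv w g) :
    N.HasWeakDeriv (c • w) (c • g) := by
  intro e φ h1 h2 h3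
  have e1 : ∫ y in Ioo 0 (N.len e), N.fn (c • g) e y * φ y =
      ∫ y in Ioo 0 (N.len e), c * (N.fn g e y * φ y) := by
    refine integral_congr_ae ?_
    filter_upwards [N.fn_smul c g e] with y hy
    rw [hy, mul_assoc]
  simp only [ev_smul, mul_assoc]
  rw [e1, integral_const_mul, integral_const_mul, hg e φ h1 h2 h3, mul_neg]

theorem hasWeakDeriv_dx {w : N.Cont} (h : w ∈ N.H1pw) : N.HasWeakDeriv w (N.dx w) := by
  obtain ⟨g, hg⟩ := h
  rwa [hg.dx_eq]

theorem dx_add {v w : N.Cont} (hv : v ∈ N.H1pw) (hw : w ∈ N.H1pw) :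
    N.dx (v + w) = N.dx v + N.dx w :=
  ((hasWeakDeriv_dx hv).add (hasWeakDeriv_dx hw)).dx_eq

theorem dx_smul (c : ℝ) {w : N.Cont} (hw : w ∈ N.H1pw) : N.dx (c • w) = c • N.dx w :=
  ((hasWeakDeriv_dx hw).smul c).dx_eq

/-- The weak derivative of a function which is affine on an interval. -/
theorem HasWeakDeriv.ae_eq_of_affine {w : N.Cont} {g : N.L2} (hg : N.HasWeakDeriv w g) {e : E}
    {a b ζ μ : ℝ} (hab : a ≤ b) (hsub : Icc a b ⊆ Icc 0 (N.len e))
    (hw : ∀ y ∈ Icc a b, N.ev w e y = ζ + μ * y) :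
    ∀ᵐ y ∂(volume.restrict (Icc a b)), N.fn g e y = μ := by
  have hsub' : Ioo a b ⊆ Ioo 0 (N.len e) := by
    have := interior_mono hsub
    rwa [interior_Icc, interior_Icc] at this
  have hgi : IntegrableOn (N.fn g e) (Ioo a b) :=
    IntegrableOn.mono_set ((Lp.memLp (g e)).integrable (by norm_num)) hsub'
  have hgi' : IntegrableOn (fun y => N.fn g e y - μ) (Ioo a b) :=
    hgi.sub (integrableOn_const (by simp))
  have key : ∀ᵐ y, y ∈ Ioo a b → N.fn g e y - μ = 0 := by
    refine isOpen_Ioo.ae_eq_zero_of_integral_contDiff_smul_eq_zero hgi'.locallyIntegrableOn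
      fun φ h1 h2 h3 => ?_
    have hd : Continuous (deriv φ) := h1.continuous_deriv (by simp)
    have hzero : ∀ y, y ∉ Ioo a b → φ y = 0 := fun y hy =>
      image_eq_zero_of_notMem_tsupport fun hy' => hy (h3 hy')
    have hzero' : ∀ y, y ∉ Ioo a b → deriv φ y = 0 := fun y hy => by
      have : y ∉ tsupport (deriv φ) := fun h => hy (h3 (tsupport_deriv_subset h))
      exact image_eq_zero_of_notMem_tsupport this
    have hweak := hg e φ h1 h2 (h3.trans hsub')
    rw [setIntegral_eq_of_subset_of_forall_sdiff_eq_zero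
        (f := fun y => N.ev w e y * deriv φ y) measurableSet_Ioo hsub'
        (fun y hy => by rw [hzero' y hy.2, mul_zero]),
      setIntegral_eq_of_subset_of_forall_sdiff_eq_zero
        (f := fun y => N.fn g e y * φ y) measurableSet_Ioo hsub'
        (fun y hy => by rw [hzero y hy.2, mul_zero])] at hweak
    -- Integration by parts; the boundary terms vanish since `φ` is supported inside `(a, b)`.
    have e1 : ∫ y in Ioo a b, N.ev w e y * deriv φ y = - ∫ y in Ioo a b, μ * φ y := by
      rw [setIntegral_congr_fun measurableSet_Ioo
        (fun y hy => by
          show _ = (ζ + μ * y) * deriv φ y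
          simp only [hw y (Ioo_subset_Icc_self hy)]),
        ← integral_Ioc_eq_integral_Ioo, ← integral_Ioc_eq_integral_Ioo,
        ← intervalIntegral.integral_of_le hab, ← intervalIntegral.integral_of_le hab,
        intervalIntegral.integral_mul_deriv_eq_deriv_mul (u' := fun _ => μ)
          (fun y _ => by simpa using ((hasDerivAt_id y).const_mul μ).const_add ζ)
          (fun y _ => (h1.differentiable (by simp) y).hasDerivAt)
          (intervalIntegrable_const) (hd.intervalIntegrable _ _),
        hzero a (by simp), hzero b (by simp)]
      ring
    have i1 : IntegrableOn (fun y => N.fn g e y * φ y) (Ioo a b) :=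
      (N.integrableOn_fn_mul g e h1.continuous h2).mono_set hsub'
    have i2 : IntegrableOn (fun y => μ * φ y) (Ioo a b) :=
      ((continuous_const.mul h1.continuous).continuousOn.integrableOn_Icc).mono_set
        Ioo_subset_Icc_self
    rw [← setIntegral_eq_integral_of_forall_compl_eq_zero (s := Ioo a b)
      (fun y hy => by rw [hzero y hy, zero_smul])]
    have e2 : (fun y => φ y • (N.fn g e y - μ)) = fun y => N.fn g e y * φ y - μ * φ y := by
      funext y
      rw [smul_eq_mul]
      ring
    rw [e2, integral_sub i1 i2]
    linarith
  rw [← restrict_Ioo_eq_restrict_Icc]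
  filter_upwards [(ae_restrict_iff' measurableSet_Ioo).2 key] with y hy
  exact sub_eq_zero.1 hy

variable (N)

theorem nodeVal_add (v w : N.Cont) (e : E) (ν : V) :
    N.nodeVal (v + w) e ν = N.nodeVal v e ν + N.nodeVal w e ν := by
  unfold nodeVal
  split_ifs <;> rfl

theorem nodeVal_smul (c : ℝ) (w : N.Cont) (e : E) (ν : V) :
    N.nodeVal (c • w) e ν = c * N.nodeVal w e ν := by
  unfold nodeVal
  split_ifs <;> rfl

variable [Fintype E]

theorem ip_fn (p q : N.L2) :
    N.ip (N.fn p) (N.fn q) = ∑ e, N.area e * inner ℝ (p e) (q e) := by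
  refine Finset.sum_congr rfl fun e _ => ?_
  rw [L2.inner_def]
  congr 1
  refine integral_congr_ae (Eventually.of_forall fun y => ?_)
  simp [fn, mul_comm]

/-- Testing with `p - q`, itself in `Q`, suffices. Thus the weak mass equation is an identity in
`Q`, as `∂ₓ W ⊆ Q`. -/
theorem eq_of_ip_eq {Q : Submodule ℝ N.L2} {p q : N.L2} (hp : p ∈ Q) (hq : q ∈ Q)
    (h : ∀ r ∈ Q, N.ip (N.fn p) (N.fn r) = N.ip (N.fn q) (N.fn r)) : p = q := by
  have h0 := h (p - q) (Q.sub_mem hp hq)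
  rw [ip_fn, ip_fn, ← sub_eq_zero, ← Finset.sum_sub_distrib] at h0
  simp only [← mul_sub, ← inner_sub_left] at h0
  rw [Finset.sum_eq_zero_iff_of_nonneg fun e _ =>
    mul_nonneg (N.area_pos e).le (by exact real_inner_self_nonneg)] at h0
  funext e
  have := (mul_eq_zero.1 (h0 e (Finset.mem_univ e))).resolve_left (N.area_pos e).ne'
  exact sub_eq_zero.1 (inner_self_eq_zero.1 this)

theorem ip_neg_left (p q : N.L2) : N.ip (N.fn (-p)) (N.fn q) = -N.ip (N.fn p) (N.fn q) := by
  simp [ip_fn]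

theorem eq_zero_of_ip_ev_eq_zero {w : N.Cont} (h : N.ip (N.ev w) (N.ev w) = 0) : w = 0 := by
  rw [ip, Finset.sum_eq_zero_iff_of_nonneg fun e _ => mul_nonneg (N.area_pos e).le
    (integral_nonneg fun y => mul_self_nonneg _)] at h
  refine N.eq_zero_of_ev_eq_zero fun e => ?_
  have h0 := (mul_eq_zero.1 (h e (Finset.mem_univ e))).resolve_left (N.area_pos e).ne'
  rw [setIntegral_eq_zero_iff_of_nonneg_ae (Eventually.of_forall fun y => mul_self_nonneg _)
    ((N.integrableOn_ev_mul w e (N.continuous_ev w e) _ _).mono_set Ioo_subset_Icc_self),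
    restrict_Ioo_eq_restrict_Icc] at h0
  refine Measure.eqOn_Icc_of_ae_eq volume (N.len_pos e).ne ?_ (N.continuous_ev w e).continuousOn
    continuousOn_const
  filter_upwards [h0] with y hy
  exact mul_self_eq_zero.1 hy

theorem trace_add (v w : N.Cont) : N.trace (v + w) = N.trace v + N.trace w := by
  funext ν
  simp [trace, nodeFlux, nodeVal_add, mul_add, Finset.sum_add_distrib]

theorem trace_smul (c : ℝ) (w : N.Cont) : N.trace (c • w) = c • N.trace w := by
  funext ν
  simp [trace, nodeFlux, nodeVal_smul, mul_left_comm, Finset.mul_sum]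

end Network

/-! ### Cell means, cell forms and evaluation of the quadrature -/

namespace Mesh

variable {N : Network V E} (K : Mesh N J)

/-- The mean value on the cell `j`. -/
noncomputable def mean (j : J) (q : N.L2) : ℝ :=
  (K.hi j - K.lo j)⁻¹ * ∫ y in K.cell j, N.fn q (K.edge j) y

theorem integral_cell_const (j : J) (c : ℝ) :
    ∫ _ in K.cell j, c = (K.hi j - K.lo j) * c := by
  rw [setIntegral_const, cell, measureReal_def, Real.volume_Icc,
    ENNReal.toReal_ofReal (sub_nonneg.2 (K.lo_lt_hi j).le), smul_eq_mul]

theorem ae_cell {j : J} {p : ℝ → Prop}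
    (h : ∀ᵐ y ∂(volume.restrict (Ioo 0 (N.len (K.edge j)))), p y) :
    ∀ᵐ y ∂(volume.restrict (K.cell j)), p y := by
  rw [restrict_Ioo_eq_restrict_Icc] at h
  exact ae_restrict_of_ae_restrict_of_subset (K.sub j) h

theorem ae_cell_neBot (j : J) : (ae (volume.restrict (K.cell j))).NeBot := by
  rw [ae_neBot, Ne, Measure.restrict_eq_zero, cell, Real.volume_Icc]
  simp [K.lo_lt_hi j]

variable {K}

theorem mean_eq {j : J} {q : N.L2} {c : ℝ}
    (h : ∀ᵐ y ∂(volume.restrict (K.cell j)), N.fn q (K.edge j) y = c) : K.mean j q = c := by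
  rw [mean, integral_congr_ae h, integral_cell_const, inv_mul_cancel_left₀]
  exact (sub_pos.2 (K.lo_lt_hi j)).ne'

theorem ae_eq_mean {q : N.L2} (hq : q ∈ K.Qf) (j : J) :
    ∀ᵐ y ∂(volume.restrict (K.cell j)), N.fn q (K.edge j) y = K.mean j q := by
  obtain ⟨c, hc⟩ := hq j
  rwa [mean_eq hc]

theorem mean_add {p q : N.L2} (hp : p ∈ K.Qf) (hq : q ∈ K.Qf) (j : J) :
    K.mean j (p + q) = K.mean j p + K.mean j q := by
  refine mean_eq ?_
  filter_upwards [ae_eq_mean hp j, ae_eq_mean hq j, K.ae_cell (N.fn_add p q (K.edge j))]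
    with y h1 h2 h3
  rw [h3, h1, h2]

theorem mean_smul (c : ℝ) {q : N.L2} (hq : q ∈ K.Qf) (j : J) :
    K.mean j (c • q) = c * K.mean j q := by
  refine mean_eq ?_
  filter_upwards [ae_eq_mean hq j, K.ae_cell (N.fn_smul c q (K.edge j))] with y h1 h2
  rw [h2, h1]

theorem inRange_iff {I : Finset J} {M : ℝ} {q : N.L2} (hq : q ∈ K.Qf) :
    K.InRange I M q ↔ ∀ i : I, K.mean i q ∈ Ioo 0 M := by
  constructor
  · intro h i
    -- Cells have positive length, so some point satisfies both almost-everywhere statements.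
    have := K.ae_cell_neBot i
    obtain ⟨y, h1, h2⟩ := ((h i i.2).and (ae_eq_mean hq i)).exists
    rwa [← h2]
  · intro h i hi
    filter_upwards [ae_eq_mean hq i] with y hy
    rw [hy]
    exact h ⟨i, hi⟩

variable (K)

theorem integrableOn_cell_ev_mul_ev (j : J) (v w : N.Cont) :
    IntegrableOn (fun y => N.ev v (K.edge j) y * N.ev w (K.edge j) y) (K.cell j) :=
  N.integrableOn_ev_mul v _ (N.continuous_ev w _) _ _

/-- The scalar product of `L²` on the cell `j`. -/
noncomputable def cellForm (j : J) : N.Cont →ₗ[ℝ] N.Cont →ₗ[ℝ] ℝ :=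
  LinearMap.mk₂ ℝ (fun v w => ∫ y in K.cell j, N.ev v (K.edge j) y * N.ev w (K.edge j) y)
    (fun v v' w => by
      rw [← integral_add (K.integrableOn_cell_ev_mul_ev j v w)
        (K.integrableOn_cell_ev_mul_ev j v' w)]
      simp only [Network.ev_add, add_mul])
    (fun c v w => by
      rw [smul_eq_mul, ← integral_const_mul]
      simp only [Network.ev_smul, mul_assoc])
    (fun v w w' => by
      rw [← integral_add (K.integrableOn_cell_ev_mul_ev j v w)
        (K.integrableOn_cell_ev_mul_ev j v w')]
      simp only [Network.ev_add, mul_add])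
    (fun c v w => by
      rw [smul_eq_mul, ← integral_const_mul]
      simp only [Network.ev_smul, mul_left_comm])

theorem cellForm_apply (j : J) (v w : N.Cont) :
    K.cellForm j v w = ∫ y in K.cell j, N.ev v (K.edge j) y * N.ev w (K.edge j) y := rfl

theorem cellForm_nonneg (j : J) (w : N.Cont) : 0 ≤ K.cellForm j w w :=
  integral_nonneg fun _ => mul_self_nonneg _

theorem cellForm_symm (j : J) (v w : N.Cont) : K.cellForm j v w = K.cellForm j w v := by
  simp only [cellForm_apply, mul_comm]

/-- Inverse estimate on a cell. -/
theorem mean_dx_sq_le [Fintype E] {w : N.Cont} (hw : w ∈ K.Wf) (j : J) :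
    K.mean j (N.dx w) ^ 2 ≤ 12 / (K.hi j - K.lo j) ^ 3 * K.cellForm j w w := by
  obtain ⟨ζ, μ, h⟩ := hw.2 j
  have hlt := K.lo_lt_hi j
  have hd : K.mean j (N.dx w) = μ :=
    mean_eq ((Network.hasWeakDeriv_dx hw.1.1).ae_eq_of_affine hlt.le (K.sub j) h)
  have hint : K.cellForm j w w =
      ∫ y in (K.lo j)..(K.hi j), (ζ ^ 2 + 2 * ζ * μ * y + μ ^ 2 * y ^ 2) := by
    rw [intervalIntegral.integral_of_le hlt.le, ← integral_Icc_eq_integral_Ioc, cellForm_apply]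
    refine setIntegral_congr_fun measurableSet_Icc fun y hy => ?_
    simp only [h y hy]
    ring
  have hval : ∫ y in (K.lo j)..(K.hi j), (ζ ^ 2 + 2 * ζ * μ * y + μ ^ 2 * y ^ 2) =
      ζ ^ 2 * (K.hi j - K.lo j) + ζ * μ * (K.hi j ^ 2 - K.lo j ^ 2)
        + μ ^ 2 * (K.hi j ^ 3 - K.lo j ^ 3) / 3 := by
    rw [intervalIntegral.integral_add (Continuous.intervalIntegrable (by fun_prop) _ _)
      (Continuous.intervalIntegrable (by fun_prop) _ _),
      intervalIntegral.integral_add (Continuous.intervalIntegrable (by fun_prop) _ _)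
      (Continuous.intervalIntegrable (by fun_prop) _ _), intervalIntegral.integral_const,
      intervalIntegral.integral_const_mul, intervalIntegral.integral_const_mul, integral_id,
      integral_pow, smul_eq_mul]
    push_cast
    ring
  have hpos : 0 < (K.hi j - K.lo j) ^ 3 := pow_pos (sub_pos.2 hlt) 3
  rw [hd, hint, hval, div_mul_eq_mul_div, le_div_iff₀ hpos]
  -- With `h` the cell length, `∫ (ζ + μy)² = h (ζ + μ·mid)² + μ² h³ / 12`; dropping the midpoint
  -- term gives the constant `12 / h³`.
  have hsq : 0 ≤ (K.hi j - K.lo j) * (ζ + μ * (K.lo j + K.hi j) / 2) ^ 2 :=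
    mul_nonneg (sub_nonneg.2 hlt.le) (sq_nonneg _)
  nlinarith [hsq]

variable {I : Finset J} {ξ : J → ℝ}

/-- A density constant on each cell leaves the integral. By the convention for division by zero this
needs no positivity, so the identity holds at every state and can be used under a time derivative.
-/
theorem quad_quotient {ρ : N.L2} (hρ : ρ ∈ K.Qf) (v w : N.Cont) :
    K.quad I ξ (fun e y => N.ev v e y / N.fn ρ e y) (N.ev w) =
      ∑ i : I, (K.mean i ρ)⁻¹ * (ξ i * K.cellForm i v w) := by
  rw [quad, ← Finset.sum_coe_sort]
  refine Finset.sum_congr rfl fun i _ => ?_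
  have : ∫ y in K.cell i, N.ev v (K.edge i) y / N.fn ρ (K.edge i) y * N.ev w (K.edge i) y =
      ∫ y in K.cell i, (K.mean i ρ)⁻¹ * (N.ev v (K.edge i) y * N.ev w (K.edge i) y) := by
    refine integral_congr_ae ?_
    filter_upwards [ae_eq_mean hρ i] with y hy
    rw [hy]
    ring
  rw [this, integral_const_mul, ← cellForm_apply]
  ring

theorem quad_friction {ρ : N.L2} (hρ : ρ ∈ K.Qf) (v w : N.Cont) :
    K.quad I ξ (fun e y => N.fn ρ e y ^ (-2 : ℤ) * N.ev v e y) (N.ev w) =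
      ∑ i : I, (K.mean i ρ ^ 2)⁻¹ * (ξ i * K.cellForm i v w) := by
  rw [quad, ← Finset.sum_coe_sort]
  refine Finset.sum_congr rfl fun i _ => ?_
  have : ∫ y in K.cell i, N.fn ρ (K.edge i) y ^ (-2 : ℤ) * N.ev v (K.edge i) y
        * N.ev w (K.edge i) y =
      ∫ y in K.cell i, (K.mean i ρ ^ 2)⁻¹ * (N.ev v (K.edge i) y * N.ev w (K.edge i) y) := by
    refine integral_congr_ae ?_
    filter_upwards [ae_eq_mean hρ i] with y hy
    rw [hy, zpow_neg, mul_assoc]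
    norm_cast
  rw [this, integral_const_mul, ← cellForm_apply]
  ring

theorem quad_pressure {ρ g : N.L2} (hρ : ρ ∈ K.Qf) (hg : g ∈ K.Qf) (P : ℝ → ℝ) (v : N.Cont) :
    K.quad I ξ (fun e y => deriv P (N.fn ρ e y) + N.ev v e y ^ 2 / (2 * N.fn ρ e y ^ 2))
        (N.fn g) =
      ∑ i : I, (ξ i * (K.hi i - K.lo i) * deriv P (K.mean i ρ)
        + ξ i * K.cellForm i v v / (2 * K.mean i ρ ^ 2)) * K.mean i g := by
  rw [quad, ← Finset.sum_coe_sort]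
  refine Finset.sum_congr rfl fun i _ => ?_
  have : ∫ y in K.cell i, (deriv P (N.fn ρ (K.edge i) y)
        + N.ev v (K.edge i) y ^ 2 / (2 * N.fn ρ (K.edge i) y ^ 2)) * N.fn g (K.edge i) y =
      ∫ y in K.cell i, (deriv P (K.mean i ρ) * K.mean i g + K.mean i g / (2 * K.mean i ρ ^ 2)
        * (N.ev v (K.edge i) y * N.ev v (K.edge i) y)) := by
    refine integral_congr_ae ?_
    filter_upwards [ae_eq_mean hρ i, ae_eq_mean hg i] with y h1 h2
    rw [h1, h2]
    ring
  have hfin : IntegrableOn (fun _ : ℝ => deriv P (K.mean i ρ) * K.mean i g) (K.cell i) :=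
    continuousOn_const.integrableOn_Icc
  rw [this, integral_add hfin ((K.integrableOn_cell_ev_mul_ev i v v).const_mul _),
    integral_cell_const, integral_const_mul, ← cellForm_apply]
  ring

variable [Fintype E] {Q : Submodule ℝ N.L2} {W : Submodule ℝ N.Cont}

/-- The cells in `I` need not cover the network; definiteness comes from the bound of the `L²` norm
by the quadrature norm on `W`. -/
theorem eq_zero_of_cellForm_eq_zero (hc : K.CompatibleForm I ξ Q W) {w : N.Cont} (hw : w ∈ W)
    (h : ∀ i ∈ I, ξ i * K.cellForm i w w = 0) : w = 0 := by
  obtain ⟨C, -, hC⟩ := hc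
  have h0 : K.quad I ξ (N.ev w) (N.ev w) = 0 := Finset.sum_eq_zero h
  have h1 := (hC (N.ev w) (Or.inr ⟨w, hw, rfl⟩)).2
  rw [h0, Real.sqrt_zero, mul_zero, Real.sqrt_le_left le_rfl] at h1
  have hnn : 0 ≤ N.ip (N.ev w) (N.ev w) := Finset.sum_nonneg fun e _ =>
    mul_nonneg (N.area_pos e).le (integral_nonneg fun y => mul_self_nonneg _)
  exact N.eq_zero_of_ip_ev_eq_zero (le_antisymm (by simpa using h1) hnn)

/-- The mean value as a linear functional on a space of piecewise constant functions. -/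
noncomputable def meanₗ (hQf : (Q : Set N.L2) ⊆ K.Qf) (j : J) : Q →ₗ[ℝ] ℝ where
  toFun q := K.mean j q
  map_add' p q := mean_add (hQf p.2) (hQf q.2) j
  map_smul' c q := mean_smul c (hQf q.2) j

end Mesh

/-! ### The network model as a cell system -/

namespace Network

variable {N : Network V E} [Fintype E] {Q : Submodule ℝ N.L2} {W : Submodule ℝ N.Cont}

theorem CompatibleSpaces.dx_mem (h : N.CompatibleSpaces Q W) {w : N.Cont} (hw : w ∈ W) :
    N.dx w ∈ Q := by
  have : N.dx w ∈ (Q : Set N.L2) := h.Q_eq ▸ mem_image_of_mem N.dx hw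
  exact this

/-- The broken derivative as a linear map between compatible spaces. -/
noncomputable def CompatibleSpaces.dxₗ (h : N.CompatibleSpaces Q W) : W →ₗ[ℝ] Q where
  toFun w := ⟨N.dx w, h.dx_mem w.2⟩
  map_add' v w := Subtype.ext (dx_add (h.W_sub v.2).1 (h.W_sub w.2).1)
  map_smul' c w := Subtype.ext (dx_smul c (h.W_sub w.2).1)

/-- The pairing of boundary data with boundary values. -/
noncomputable def tracePairing (N : Network V E) : (N.bdry → ℝ) →ₗ[ℝ] N.Cont →ₗ[ℝ] ℝ :=
  LinearMap.mk₂ ℝ (fun u w => ∑ ν, u ν * N.trace w ν)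
    (fun u u' w => by simp [add_mul, Finset.sum_add_distrib])
    (fun c u w => by simp [mul_assoc, Finset.mul_sum])
    (fun u w w' => by simp [trace_add, mul_add, Finset.sum_add_distrib])
    (fun c u w => by simp [trace_smul, mul_left_comm, Finset.mul_sum])

end Network

section Model

variable [Fintype E] {N : Network V E} (K : Mesh N J) {Q : Submodule ℝ N.L2}
  {W : Submodule ℝ N.Cont} (I : Finset J) {ξ : J → ℝ}

/-- The cell data of the reduced model on a network. -/
noncomputable def Mesh.toCellSystem (hQf : (Q : Set N.L2) ⊆ K.Qf) (hWf : (W : Set N.Cont) ⊆ K.Wf)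
    (hQW : N.CompatibleSpaces Q W) (hξ : ∀ i ∈ I, 0 < ξ i) (hc : K.CompatibleForm I ξ Q W)
    [FiniteDimensional ℝ Q] [FiniteDimensional ℝ W] : CellSystem I Q W (N.bdry → ℝ) where
  rv i := LinearMap.toContinuousLinearMap (K.meanₗ hQf i)
  b i := LinearMap.toContinuousBilinearMap (ξ i • (K.cellForm i).domRestrict₁₂ W W)
  D := LinearMap.toContinuousLinearMap hQW.dxₗ
  κ i := ξ i * (K.hi i - K.lo i)
  τ := LinearMap.toContinuousBilinearMap (N.tracePairing.compl₂ W.subtype)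
  κ_pos i := mul_pos (hξ i i.2) (sub_pos.2 (K.lo_lt_hi i))
  b_symm i v w := congrArg (ξ i * ·) (K.cellForm_symm i v w)
  b_nonneg i w := mul_nonneg (hξ i i.2).le (K.cellForm_nonneg i w)
  b_definite w h := Subtype.ext (K.eq_zero_of_cellForm_eq_zero hc w.2 fun i hi => h ⟨i, hi⟩)
  inverse_estimate := by
    have hpos : ∀ i : I, 0 ≤ 12 / (K.hi i - K.lo i) ^ 3 / ξ i := fun i =>
      div_nonneg (div_nonneg (by norm_num) (pow_nonneg (sub_nonneg.2 (K.lo_lt_hi i).le) 3))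
        (hξ i i.2).le
    -- The sum dominates the constant of each cell; the summand `1` keeps it positive when `I` is
    -- empty.
    refine ⟨1 + ∑ i : I, 12 / (K.hi i - K.lo i) ^ 3 / ξ i,
      add_pos_of_pos_of_nonneg one_pos (Finset.sum_nonneg fun i _ => hpos i), fun i w => ?_⟩
    have h1 := K.mean_dx_sq_le (hWf w.2) i
    have h2 : 12 / (K.hi i - K.lo i) ^ 3 / ξ i ≤
        1 + ∑ i : I, 12 / (K.hi i - K.lo i) ^ 3 / ξ i :=
      (Finset.single_le_sum (f := fun i : I => 12 / (K.hi i - K.lo i) ^ 3 / ξ i)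
        (fun i _ => hpos i) (Finset.mem_univ i)).trans (le_add_of_nonneg_left zero_le_one)
    have h3 : 12 / (K.hi i - K.lo i) ^ 3 * K.cellForm i w w =
        12 / (K.hi i - K.lo i) ^ 3 / ξ i * (ξ i * K.cellForm i w w) := by
      have := (hξ i i.2).ne'
      field_simp
    rw [h3] at h1
    exact h1.trans (mul_le_mul_of_nonneg_right h2
      (mul_nonneg (hξ i i.2).le (K.cellForm_nonneg i w)))

/-- The reduced model on a network is the evolution of its cell data. -/
theorem isSolution_iff_cellSystem {hQf : (Q : Set N.L2) ⊆ K.Qf} {hWf : (W : Set N.Cont) ⊆ K.Wf}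
    {hQW : N.CompatibleSpaces Q W} {hξ : ∀ i ∈ I, 0 < ξ i} {hc : K.CompatibleForm I ξ Q W}
    [FiniteDimensional ℝ Q] [FiniteDimensional ℝ W] {M : ℝ} {P : ℝ → ℝ} {T : ℝ}
    {u : ℝ → N.bdry → ℝ} {ρ₀ : Q} {m₀ : W} {x : ℝ → Q × W} :
    IsSolution K I ξ Q W M P (fun ρ _ => ρ ^ (-2 : ℤ)) T u ρ₀ m₀ x ↔
      (K.toCellSystem I hQf hWf hQW hξ hc).IsSolution M P T u (ρ₀, m₀) x := by
  have hmass : ∀ t, (∀ q ∈ Q, N.ip (N.fn ((derivWithin x (Ico 0 T) t).1 : N.L2)) (N.fn q)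
      = - N.ip (N.fn (N.dx (x t).2)) (N.fn q)) ↔
      (derivWithin x (Ico 0 T) t).1 = -(K.toCellSystem I hQf hWf hQW hξ hc).D (x t).2 := by
    intro t
    constructor
    · intro h
      refine Subtype.ext (N.eq_of_ip_eq (Q := Q) (SetLike.coe_mem _) (SetLike.coe_mem _)
        fun q hq => (h q hq).trans (N.ip_neg_left _ _).symm)
    · intro h q _
      rw [h]
      exact N.ip_neg_left _ _
  have hmom : ∀ w : W, (fun s => K.quad I ξ
      (fun e y => N.ev (x s).2 e y / N.fn (x s).1 e y) (N.ev w)) =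
      fun s => ∑ i, ((K.toCellSystem I hQf hWf hQW hξ hc).rv i (x s).1)⁻¹ *
        (K.toCellSystem I hQf hWf hQW hξ hc).b i (x s).2 w :=
    fun w => funext fun s => K.quad_quotient (hQf (x s).1.2) _ _
  have hload : ∀ t, ∀ w : W, K.quad I ξ
      (fun e y => deriv P (N.fn (x t).1 e y) + (N.ev (x t).2 e y) ^ 2 / (2 * (N.fn (x t).1 e y) ^ 2))
      (N.fn (N.dx w)) - K.quad I ξ
      (fun e y => (N.fn (x t).1 e y) ^ (-2 : ℤ) * N.ev (x t).2 e y) (N.ev w)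
        + ∑ ν, u t ν * N.trace w ν =
      (K.toCellSystem I hQf hWf hQW hξ hc).load P (x t) (u t) w := by
    intro t w
    rw [CellSystem.load_apply, K.quad_pressure (hQf (x t).1.2) (hQf (hQW.dx_mem w.2)),
      K.quad_friction (hQf (x t).1.2)]
    rfl
  constructor
  · intro h
    refine ⟨h.contDiff, h.init, fun t ht => (Mesh.inRange_iff (hQf (x t).1.2)).1 (h.inRange t ht),
      fun t ht => (hmass t).1 (h.mass t ht), fun t ht w => ?_⟩
    rw [← hmom, ← hload]
    exact h.momentum t ht w w.2
  · intro h
    refine ⟨h.contDiff, h.init,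
      fun t ht => (Mesh.inRange_iff (hQf (x t).1.2)).2 (h.mem_domain t ht),
      fun t ht => (hmass t).2 (h.mass t ht), fun t ht w hw => ?_⟩
    have := h.momentum t ht ⟨w, hw⟩
    rw [← hmom, ← hload] at this
    exact this

end Model

end GasNet

theorem mainTheorem1 {V E J : Type*} [Fintype E] [Fintype J]
    (N : GasNet.Network V E) (K : GasNet.Mesh N J)
    (Q : Submodule ℝ N.L2) (W : Submodule ℝ N.Cont)
    (hQf : (Q : Set N.L2) ⊆ K.Qf) (hWf : (W : Set N.Cont) ⊆ K.Wf)
    (hQW : N.CompatibleSpaces Q W)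
    (I : Finset J) (ξ : J → ℝ) (hξ : ∀ i ∈ I, 0 < ξ i) (hc : K.CompatibleForm I ξ Q W)
    (M : ℝ) (hM : 0 < M) (P : ℝ → ℝ) (hP : GasNet.PressurePotential M P)
    (ρ₀ : Q) (m₀ : W) (hρ₀ : K.InRange I M ρ₀)
    (T : ℝ) (hT : 0 < T) (u : ℝ → N.bdry → ℝ) (hu : ContinuousOn u (Set.Icc 0 T)) :
    (∃ x : ℝ → Q × W,
        GasNet.IsSolution K I ξ Q W M P (fun ρ _ => ρ ^ (-2 : ℤ)) T u ρ₀ m₀ x) ∧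
      ∀ x y : ℝ → Q × W,
        GasNet.IsSolution K I ξ Q W M P (fun ρ _ => ρ ^ (-2 : ℤ)) T u ρ₀ m₀ x →
        GasNet.IsSolution K I ξ Q W M P (fun ρ _ => ρ ^ (-2 : ℤ)) T u ρ₀ m₀ y →
        Set.EqOn x y (Set.Ico 0 T) := by
  have : FiniteDimensional ℝ Q := hQW.finite_Q
  have : FiniteDimensional ℝ W := hQW.finite_W
  simp only [GasNet.isSolution_iff_cellSystem (hQf := hQf) (hWf := hWf) (hQW := hQW) (hξ := hξ)
    (hc := hc)]
  exact (K.toCellSystem I hQf hWf hQW hξ hc).existsUnique_solution hP hM hT hu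
    ((GasNet.Mesh.inRange_iff (hQf ρ₀.2)).1 hρ₀)
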